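/- All matroids are finite and simple. A matroid is binary if it is representable over $GF(2)$. For a simple binary matroid $M$ with rank $r(M)$ and an integer $k\ge r(M)$, the $(GF(2),k)$-complement of $M$ is the matroid $PG(k-1,2)\backslash T$, where $T$ is a set of points of the binary projective geometry $PG(k-1,2)$ with $M\cong PG(k-1,2)|T$; it is well defined up to isomorphism. Write $M^c$ for the $(GF(2),r(M))$-complement of $M$. The class of binary comatroids is the smallest class of matroids (closed under isomorphism) that contains the empty matroid $U_{0,0}$, is closed under direct sums, and contains the $(GF(2),t)$-complement of each of its members $M$ for all $t\ge r(M)$. A circuit is a matroid whose ground set is a circuit. **Theorem 4.9.** Let $M$ be a simple binary matroid that is not a binary comatroid, but such that $M|F$ is a binary comatroid for every proper flat $F$ of $M$. If $r(M)\ge 6$, then $M$ or $M^c$ is a circuit. -/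

import Mathlib

open Set

universe u v

namespace Matroid

/-- Two matroids are isomorphic if there is a bijection between their ground sets under which
independent sets correspond to independent sets. -/
def IsIsomorphic {α : Type u} {β : Type v} (M : Matroid α) (N : Matroid β) : Prop :=
  ∃ e : M.E ≃ N.E, ∀ I : Set M.E,
    M.Indep (Subtype.val '' I) ↔ N.Indep (Subtype.val '' (e '' I))

/-- A matroid is simple if it has no loops and no parallel pairs, that is, if every set of at most
two elements is independent (the case `e = f` says that there are no loops). -/
def IsSimple {α : Type u} (M : Matroid α) : Prop :=
  ∀ e ∈ M.E, ∀ f ∈ M.E, M.Indep {e, f}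

/-- A matroid is binary if it is represented by vectors in some `GF(2)^k`. (Such a matroid has
finite rank, and it is finite if it is simple.) -/
def IsBinary {α : Type u} (M : Matroid α) : Prop :=
  ∃ (k : ℕ) (v : α → (Fin k → ZMod 2)), ∀ I ⊆ M.E, M.Indep I ↔ LinearIndepOn (ZMod 2) v I

/-- The binary projective geometry `PG(k-1, 2)` of rank `k`. As the only nonzero scalar of `GF(2)`
is `1`, its points are the nonzero vectors of `GF(2)^k`; independence is linear independence. -/
def binaryPG (k : ℕ) : Matroid (Fin k → ZMod 2) :=
  (IndepMatroid.ofFinite (E := {x | x ≠ 0}) (Set.toFinite _)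
    (fun I => LinearIndepOn (ZMod 2) id I)
    (linearIndepOn_empty _ _)
    (fun _ _ hJ hIJ => hJ.mono hIJ)
    (by
      classical
      intro I J hI hJ hlt
      by_contra! hcon
      have hJI : J ⊆ (Submodule.span (ZMod 2) I : Set (Fin k → ZMod 2)) := by
        intro x hx
        by_cases hxI : x ∈ I
        · exact Submodule.subset_span hxI
        · by_contra hxs
          exact hcon x hx hxI (hI.id_insert hxs)
      have h1 : J.ncard = Module.finrank (ZMod 2) (Submodule.span (ZMod 2) J) := by
        have := finrank_span_set_eq_card (R := ZMod 2) (s := J) hJ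
        rw [this, Set.ncard_eq_toFinset_card']
      have h2 : I.ncard = Module.finrank (ZMod 2) (Submodule.span (ZMod 2) I) := by
        have := finrank_span_set_eq_card (R := ZMod 2) (s := I) hI
        rw [this, Set.ncard_eq_toFinset_card']
      have h3 := Submodule.finrank_mono (Submodule.span_le.2 hJI)
      omega)
    (fun _ hI x hx => hI.ne_zero hx)).matroid

@[simp] theorem binaryPG_ground (k : ℕ) : (binaryPG k).E = {x | x ≠ 0} := rfl

@[simp] theorem binaryPG_indep (k : ℕ) (I : Set (Fin k → ZMod 2)) :
    (binaryPG k).Indep I ↔ LinearIndepOn (ZMod 2) id I := Iff.rfl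

/-- `N` is (isomorphic to) the `(GF(2), k)`-complement of `M`: for some set `T` of points of
`PG(k-1, 2)`, the matroid `M` is isomorphic to the restriction of `PG(k-1, 2)` to `T`, and `N` is
isomorphic to `PG(k-1, 2)` with `T` deleted. Existence of `T` forces the rank of `M` to be at
most `k`. -/
def IsBinaryComplement {α : Type u} {β : Type v} (k : ℕ) (M : Matroid α) (N : Matroid β) : Prop :=
  ∃ T ⊆ (binaryPG k).E,
    M.IsIsomorphic ((binaryPG k).restrict T) ∧ N.IsIsomorphic ((binaryPG k).delete T)

/-- Binary comatroids: the smallest class of matroids (closed under isomorphism) that contains the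
empty matroid and is closed under direct sums and under taking the `(GF(2), t)`-complement
for every `t` that is at least the rank. -/
inductive IsBinaryComatroid : ∀ {α : Type u}, Matroid α → Prop
  | empty (α : Type u) : IsBinaryComatroid (emptyOn α)
  | directSum {α β : Type u} {M : Matroid α} {N : Matroid β} :
      IsBinaryComatroid M → IsBinaryComatroid N → IsBinaryComatroid (M.sum N)
  | complement {α β : Type u} {M : Matroid α} {N : Matroid β} (t : ℕ) :
      IsBinaryComatroid M → M.eRank ≤ t → IsBinaryComplement t M N → IsBinaryComatroid N
  | iso {α β : Type u} {M : Matroid α} {N : Matroid β} :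
      IsBinaryComatroid M → M.IsIsomorphic N → IsBinaryComatroid N

/-- The induced-restriction-minimal binary non-comatroids: simple binary matroids that are not
binary comatroids, but whose restriction to every proper flat is a binary comatroid. -/
structure IsMinimalBinaryNonComatroid {α : Type u} (M : Matroid α) : Prop where
  isSimple : M.IsSimple
  isBinary : M.IsBinary
  not_comatroid : ¬ M.IsBinaryComatroid
  flat_comatroid : ∀ F, M.IsFlat F → F ≠ M.E → (M.restrict F).IsBinaryComatroid

end Matroid

/-! ### Linear algebra over GF(2): hyperplanes that avoid prescribed subspaces. -/

section BinarySpace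

open Module Submodule

variable {V : Type*} [AddCommGroup V] [Module (ZMod 2) V]

/-! Represent `M` by a spanning set X of nonzero vectors of GF(2)^r and let Y be the other nonzero
vectors. A comatroid or its complement splits in every nonzero subspace
(`IsBinaryComatroid.hereditarilySplits`); this goes by induction on the construction and uses that
binary representations are unique. Conversely, a splitting of X or Y in the whole space exhibits it
as a direct sum of traces on proper subspaces, and these are comatroids, being traces of M on proper
flats or complements of such. Hence for minimal `M` neither X nor Y splits in the whole space, while
in each nonzero proper subspace one of them does. The rest is geometry
(`exists_isSumCircuit_of_critical`).

Two facts drive it. In dimension at least four X and Y cannot both split (`not_splits_of_splits`),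
which reduces to the connectedness of affine geometries (`not_splits_of_diff`). And a non-split part
remains non-split when an ear is attached (`not_splits_sup_span`).

If X splits in every hyperplane, take a maximal proper U in which X does not split, and a smallest
ear D. Then U and D span everything and D is all of X outside U. Closing D up inside U gives a
chordless circuit. If it spans, it is X; if not, it has only four elements, and attaching D to a
suitable hyperplane of U yields a non-split hyperplane, a contradiction.

Otherwise, up to exchanging X and Y, X does not split in some hyperplane H and Y does not split in
some H'. As H ∩ H' has dimension at least four, it must be a part of one of the two splittings, and
a third hyperplane through chosen points outside H and H' gives a contradiction
(`false_of_isHyper_of_isHyper`). -/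

theorem ZMod.two_eq_zero_or_one (c : ZMod 2) : c = 0 ∨ c = 1 := by
  revert c; decide

theorem add_eq_zero_iff_eq_of_zmodTwo {x y : V} : x + y = 0 ↔ x = y := by
  constructor
  · intro h
    have := congrArg (· + y) h
    simpa [add_assoc, ZModModule.add_self] using this
  · rintro rfl; exact ZModModule.add_self x

theorem mem_of_add_mem_left {U : Submodule (ZMod 2) V} {x y : V} (h : x + y ∈ U) (hx : x ∈ U) :
    y ∈ U := (U.add_mem_iff_right hx).1 h

theorem mem_of_add_mem_right {U : Submodule (ZMod 2) V} {x y : V} (h : x + y ∈ U) (hy : y ∈ U) :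
    x ∈ U := (U.add_mem_iff_left hy).1 h

theorem mem_span_iff_exists_sum {S : Set V} {x : V} :
    x ∈ span (ZMod 2) S ↔ ∃ D : Finset V, (D : Set V) ⊆ S ∧ ∑ d ∈ D, d = x := by
  constructor
  · intro h
    obtain ⟨c, hc, rfl⟩ := Submodule.mem_span_set.1 h
    refine ⟨c.support, hc, Finset.sum_congr rfl fun i hi => ?_⟩
    rcases ZMod.two_eq_zero_or_one (c i) with h0 | h1
    · simp [h0] at hi
    · simp [h1]
  · rintro ⟨D, hD, rfl⟩
    exact sum_mem fun i hi => subset_span (hD hi)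

theorem linearIndepOn_zmodTwo_iff {ι : Type*} {v : ι → V} {I : Set ι} :
    LinearIndepOn (ZMod 2) v I ↔
      ∀ D : Finset ι, (D : Set ι) ⊆ I → ∑ d ∈ D, v d = 0 → D = ∅ := by
  classical
  rw [linearIndepOn_iff']
  constructor
  · intro h D hD h0
    by_contra hne
    obtain ⟨d, hd⟩ := Finset.nonempty_iff_ne_empty.2 hne
    exact one_ne_zero (h D (fun _ => 1) hD (by simpa using h0) d hd)
  · intro h t g ht h0 i hi
    have := h (t.filter fun i => g i = 1) (fun j hj => ht (by simp at hj; exact hj.1)) (by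
      rw [Finset.sum_filter]
      refine (Finset.sum_congr rfl fun j _ => ?_).trans h0
      rcases ZMod.two_eq_zero_or_one (g j) with h | h <;> simp [h])
    rcases ZMod.two_eq_zero_or_one (g i) with h | h
    · exact h
    · have h' : i ∈ (t.filter fun i => g i = 1) := by simp [hi, h]
      rw [this] at h'; simp at h'

theorem mem_sup_span_singleton_zmodTwo {Z : Submodule (ZMod 2) V} {a x : V}
    (h : x ∈ Z ⊔ span (ZMod 2) {a}) : x ∈ Z ∨ x + a ∈ Z := by
  obtain ⟨z, hz, y, hy, rfl⟩ := Submodule.mem_sup.1 h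
  obtain ⟨c, rfl⟩ := Submodule.mem_span_singleton.1 hy
  rcases ZMod.two_eq_zero_or_one c with rfl | rfl
  · left; simpa using hz
  · right; simpa [add_assoc, ZModModule.add_self] using hz

theorem mem_span_singleton_zmodTwo {a x : V} (h : x ∈ span (ZMod 2) {a}) : x = 0 ∨ x = a := by
  have := mem_sup_span_singleton_zmodTwo (Z := ⊥) (a := a) (x := x) (by simpa using h)
  simpa [add_eq_zero_iff_eq_of_zmodTwo] using this

/-- Splitting a finite sum over a set and its complement inside a larger set. -/
theorem sum_sdiff_eq_add [DecidableEq V] {D Z : Finset V} (h : Z ⊆ D) :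
    ∑ d ∈ D \ Z, d = ∑ d ∈ D, d + ∑ d ∈ Z, d := by
  rw [← Finset.sum_sdiff h, add_assoc, ZModModule.add_self, add_zero]

theorem eq_zero_of_mem_disjoint {A B : Submodule (ZMod 2) V} (h : Disjoint A B) {x : V}
    (ha : x ∈ A) (hb : x ∈ B) : x = 0 := Submodule.disjoint_def.1 h x ha hb

variable [FiniteDimensional (ZMod 2) V]

/-- Subspaces of codimension one. -/
def IsHyper (J : Submodule (ZMod 2) V) : Prop := finrank (ZMod 2) J + 1 = finrank (ZMod 2) V

theorem isHyper_ker {φ : V →ₗ[ZMod 2] ZMod 2} (h : φ ≠ 0) : IsHyper (LinearMap.ker φ) := by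
  have h1 := LinearMap.finrank_range_add_finrank_ker φ
  have : LinearMap.range φ = ⊤ := LinearMap.range_eq_top.2 (LinearMap.surjective h)
  rw [this] at h1
  simp at h1
  unfold IsHyper; omega

theorem exists_isHyper_notMem {Z : Submodule (ZMod 2) V} {x : V} (hx : x ∉ Z) :
    ∃ J, IsHyper J ∧ Z ≤ J ∧ x ∉ J := by
  obtain ⟨φ, hφ, hZ⟩ := Submodule.exists_le_ker_of_notMem hx
  exact ⟨_, isHyper_ker (fun h => hφ (by simp [h])), hZ, by simpa using hφ⟩

theorem IsHyper.sup_span {J : Submodule (ZMod 2) V} (hJ : IsHyper J) {x : V} (hx : x ∉ J) :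
    J ⊔ span (ZMod 2) {x} = ⊤ := by
  apply Submodule.eq_top_of_finrank_eq
  have h1 : finrank (ZMod 2) J < finrank (ZMod 2) ↥(J ⊔ span (ZMod 2) {x}) := by
    apply Submodule.finrank_lt_finrank_of_lt
    refine lt_of_le_of_ne le_sup_left fun h => hx ?_
    rw [h]; exact mem_sup_right (mem_span_singleton_self x)
  have h2 := Submodule.finrank_le (J ⊔ span (ZMod 2) {x})
  unfold IsHyper at hJ; omega

theorem IsHyper.add_mem {J : Submodule (ZMod 2) V} (hJ : IsHyper J) {x y : V} (hx : x ∉ J)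
    (hy : y ∉ J) : y + x ∈ J := by
  have : y ∈ J ⊔ span (ZMod 2) {x} := by rw [hJ.sup_span hx]; trivial
  exact (mem_sup_span_singleton_zmodTwo this).resolve_left hy

theorem IsHyper.finrank_inf {J U : Submodule (ZMod 2) V} (hJ : IsHyper J) (hU : ¬ U ≤ J) :
    finrank (ZMod 2) ↥(U ⊓ J) + 1 = finrank (ZMod 2) U := by
  obtain ⟨x, hx, hxJ⟩ := SetLike.not_le_iff_exists.1 hU
  have h1 := Submodule.finrank_sup_add_finrank_inf_eq U J
  have h2 : U ⊔ J = ⊤ := by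
    rw [eq_top_iff, ← hJ.sup_span hxJ]
    exact sup_le le_sup_right (le_sup_of_le_left ((span_singleton_le_iff_mem _ _).2 hx))
  rw [h2, finrank_top] at h1
  unfold IsHyper at hJ; omega

/-- Pick k in K and l in L outside Z and force k + l into the hyperplane. Then k and l lie on the
same side, so excluding k excludes l. -/
theorem exists_isHyper_not_le_not_le {Z K L : Submodule (ZMod 2) V} (hK : ¬ K ≤ Z)
    (hL : ¬ L ≤ Z) : ∃ J, IsHyper J ∧ Z ≤ J ∧ ¬ K ≤ J ∧ ¬ L ≤ J := by
  obtain ⟨k, hk, hkZ⟩ := SetLike.not_le_iff_exists.1 hK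
  obtain ⟨l, hl, hlZ⟩ := SetLike.not_le_iff_exists.1 hL
  have : k ∉ Z ⊔ span (ZMod 2) {k + l} := by
    intro h
    rcases mem_sup_span_singleton_zmodTwo h with h | h
    · exact hkZ h
    · rw [← add_assoc, ZModModule.add_self, zero_add] at h; exact hlZ h
  obtain ⟨J, hJ, hZJ, hkJ⟩ := exists_isHyper_notMem this
  have hkl : k + l ∈ J := hZJ (mem_sup_right (mem_span_singleton_self _))
  exact ⟨J, hJ, le_sup_left.trans hZJ, fun h => hkJ (h hk),
    fun h => hkJ (mem_of_add_mem_right hkl (h hl))⟩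

/-- Again k + l and k + n are forced into J so that k, l, n are excluded together. This fails
exactly when k + l + n = 0, as every hyperplane meets a line; the second dimension of N leaves room
to avoid n = k + l. -/
theorem exists_isHyper_not_le_three {K L N : Submodule (ZMod 2) V} (hK : K ≠ ⊥)
    (hL : L ≠ ⊥) (hN : 2 ≤ finrank (ZMod 2) N) :
    ∃ J, IsHyper J ∧ ¬ K ≤ J ∧ ¬ L ≤ J ∧ ¬ N ≤ J := by
  obtain ⟨k, hk, hk0⟩ := Submodule.exists_mem_ne_zero_of_ne_bot hK
  obtain ⟨l, hl, hl0⟩ := Submodule.exists_mem_ne_zero_of_ne_bot hL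
  have hNk : ¬ N ≤ span (ZMod 2) {k + l} := by
    intro h
    have h1 := Submodule.finrank_mono h
    have h2 := finrank_span_le_card (R := ZMod 2) ({k + l} : Set V)
    simp at h2; omega
  have hKk : ¬ K ≤ span (ZMod 2) {k + l} := by
    intro h
    rcases mem_span_singleton_zmodTwo (h hk) with h | h
    · exact hk0 h
    · exact hl0 (by simpa using h)
  obtain ⟨n, hn, hnZ⟩ := SetLike.not_le_iff_exists.1 hNk
  have : k ∉ span (ZMod 2) {k + l} ⊔ span (ZMod 2) {k + n} := by
    intro h
    rcases mem_sup_span_singleton_zmodTwo h with h | h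
    · rcases mem_span_singleton_zmodTwo h with h | h
      · exact hk0 h
      · exact hl0 (by simpa using h)
    · rw [← add_assoc, ZModModule.add_self, zero_add] at h; exact hnZ h
  obtain ⟨J, hJ, hZJ, hkJ⟩ := exists_isHyper_notMem this
  have hkl : k + l ∈ J := hZJ (mem_sup_left (mem_span_singleton_self _))
  have hkn : k + n ∈ J := hZJ (mem_sup_right (mem_span_singleton_self _))
  exact ⟨J, hJ, fun h => hkJ (h hk), fun h => hkJ (mem_of_add_mem_right hkl (h hl)),
    fun h => hkJ (mem_of_add_mem_right hkn (h hn))⟩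

end BinarySpace


/-! ### Split and non-split parts. -/

section Split

open Module Submodule

variable {V : Type*} [AddCommGroup V] [Module (ZMod 2) V]

/-- A set of vectors splits in a subspace `U` if its part in `U` is covered by two disjoint proper
subspaces of `U`; for `U` of dimension at least two, this means that the part in `U` does not
span `U` or is a disconnected matroid. -/
def Splits (X : Set V) (U : Submodule (ZMod 2) V) : Prop :=
  ∃ A B : Submodule (ZMod 2) V, A < U ∧ B < U ∧ Disjoint A B ∧
    ∀ x ∈ X, x ∈ U → x ∈ A ∨ x ∈ B

theorem Splits.of_le {X : Set V} {U A B : Submodule (ZMod 2) V} (hAB : Disjoint A B)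
    (hX : ∀ x ∈ X, x ∈ U → x ∈ A ∨ x ∈ B) (hA : ¬ U ≤ A) (hB : ¬ U ≤ B) : Splits X U :=
  ⟨A ⊓ U, B ⊓ U, by simpa [lt_iff_le_and_ne] using hA, by simpa [lt_iff_le_and_ne] using hB,
    hAB.mono inf_le_left inf_le_left, fun x hx hxU => (hX x hx hxU).imp (⟨·, hxU⟩) (⟨·, hxU⟩)⟩

/-- Connected parts absorb circuits: if `X` does not split in `U` and `D ⊆ X` is minimal with
nonzero sum in `U`, then `X` does not split in `U + span D`. -/
theorem not_splits_sup_span {X : Set V} {U : Submodule (ZMod 2) V} (hU : ¬ Splits X U)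
    {D : Finset V} (hD : (D : Set V) ⊆ X) (hDU : ∑ d ∈ D, d ∈ U) (hD0 : ∑ d ∈ D, d ≠ 0)
    (hmin : ∀ Z ⊂ D, ∑ d ∈ Z, d ∈ U → ∑ d ∈ Z, d = 0) :
    ¬ Splits X (U ⊔ span (ZMod 2) D) := by
  classical
  have key : ∀ A B : Submodule (ZMod 2) V, A < U ⊔ span (ZMod 2) D → Disjoint A B →
      (∀ x ∈ X, x ∈ U ⊔ span (ZMod 2) D → x ∈ A ∨ x ∈ B) → U ≤ A → False := by
    intro A B hA hAB hX hUA
    set Z := D.filter (· ∈ A) with hZ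
    have hZD : Z ⊆ D := Finset.filter_subset _ _
    -- The elements of D outside A sum to a vector of both B and A, hence to zero. So Z carries the
    -- whole sum, and minimality gives Z = D.
    have hZA : ∑ d ∈ Z, d ∈ A := sum_mem fun d hd => (Finset.mem_filter.1 hd).2
    have hWB : ∑ d ∈ D \ Z, d ∈ B := sum_mem fun d hd => by
      have hd' := Finset.mem_sdiff.1 hd
      refine (hX d (hD hd'.1) (mem_sup_right (subset_span hd'.1))).resolve_left fun h => ?_
      exact hd'.2 (Finset.mem_filter.2 ⟨hd'.1, h⟩)
    have hWA : ∑ d ∈ D \ Z, d ∈ A := by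
      rw [sum_sdiff_eq_add hZD]; exact A.add_mem (hUA hDU) hZA
    have hW0 := eq_zero_of_mem_disjoint hAB hWA hWB
    have hZs : ∑ d ∈ Z, d = ∑ d ∈ D, d := by
      rw [← Finset.sum_sdiff hZD, hW0, zero_add]
    have hZD' : Z = D := by
      by_contra hne
      exact hD0 (hZs ▸ hmin Z (lt_of_le_of_ne hZD hne) (hZs ▸ hDU))
    refine hA.not_ge (sup_le hUA (span_le.2 fun d hd => ?_))
    have hd' : d ∈ Z := by rw [hZD']; exact hd
    exact (Finset.mem_filter.1 hd').2
  rintro ⟨A, B, hA, hB, hAB, hX⟩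
  by_cases hUA : U ≤ A
  · exact key A B hA hAB hX hUA
  by_cases hUB : U ≤ B
  · exact key B A hB hAB.symm (fun x hx hxU => (hX x hx hxU).symm) hUB
  exact hU (Splits.of_le hAB (fun x hx hxU => hX x hx (mem_sup_left hxU)) hUA hUB)

variable [FiniteDimensional (ZMod 2) V]

/-- Enlarging N to a hyperplane J, the set X contains the affine geometry of points of Q outside J.
It spans Q and is connected from rank three on; in rank two it is a pair of independent points. -/
theorem not_splits_of_diff {X : Set V} {N Q : Submodule (ZMod 2) V} (hN : ¬ Q ≤ N)
    (hQ : 3 ≤ finrank (ZMod 2) Q) (hX : ∀ x ∈ Q, x ∉ N → x ∈ X) : ¬ Splits X Q := by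
  obtain ⟨q, hq, hqN⟩ := SetLike.not_le_iff_exists.1 hN
  obtain ⟨J, hJ, hNJ, hqJ⟩ := exists_isHyper_notMem hqN
  have hfr := hJ.finrank_inf (U := Q) (fun h => hqJ (h hq))
  have key : ∀ A B : Submodule (ZMod 2) V, A < Q → Disjoint A B →
      (∀ x ∈ X, x ∈ Q → x ∈ A ∨ x ∈ B) → q ∈ A → False := by
    intro A B hA hAB hsub hqA
    have hsub' : ∀ x ∈ Q, x ∉ J → x ∈ A ∨ x ∈ B := fun x hx hxJ =>
      hsub x (hX x hx fun h => hxJ (hNJ h)) hx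
    -- The points of Q outside J generate Q, so they are not all in the proper subspace A.
    obtain ⟨y, hy, hyJ, hyA⟩ : ∃ y ∈ Q, y ∉ J ∧ y ∉ A := by
      by_contra! hcon
      refine hA.not_ge fun x hx => ?_
      by_cases hxJ : x ∈ J
      · have := hcon (q + x) (Q.add_mem hq hx) fun h => hqJ (mem_of_add_mem_right h hxJ)
        exact mem_of_add_mem_left this hqA
      · exact hcon x hx hxJ
    have hyB := (hsub' y hy hyJ).resolve_left hyA
    have hn : ∀ n ∈ Q ⊓ J, n ≠ 0 → q + n ∈ B := by
      intro n hnm hn0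
      refine (hsub' (q + n) (Q.add_mem hq hnm.1)
        fun h => hqJ (mem_of_add_mem_right h hnm.2)).resolve_left fun h => ?_
      have hnA := mem_of_add_mem_left h hqA
      rcases hsub' (y + n) (Q.add_mem hy hnm.1)
        (fun h => hyJ (mem_of_add_mem_right h hnm.2)) with h1 | h1
      · exact hyA (mem_of_add_mem_right h1 hnA)
      · exact hn0 (eq_zero_of_mem_disjoint hAB hnA (mem_of_add_mem_left h1 hyB))
    -- For independent n, m in Q ⊓ J the vectors q + n, q + m and q + n + m all lie in B, and so
    -- does their sum q, which is also in A.
    obtain ⟨n, hnm, hn0⟩ := Submodule.exists_mem_ne_zero_of_ne_bot (p := Q ⊓ J) (by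
      intro h; rw [h] at hfr; simp at hfr; omega)
    have hnot : ¬ Q ⊓ J ≤ span (ZMod 2) {n} := by
      intro h
      have h1 := Submodule.finrank_mono h
      have h2 := finrank_span_le_card (R := ZMod 2) ({n} : Set V)
      simp at h2; omega
    obtain ⟨m, hmm, hms⟩ := SetLike.not_le_iff_exists.1 hnot
    have hm0 : m ≠ 0 := by rintro rfl; exact hms (zero_mem _)
    have hnm0 : n + m ≠ 0 := by
      intro h
      rw [add_eq_zero_iff_eq_of_zmodTwo] at h
      exact hms (h ▸ mem_span_singleton_self _)
    have h1 := hn n hnm hn0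
    have h2 := hn m hmm hm0
    have h3 := hn (n + m) (add_mem hnm hmm) hnm0
    rw [← add_assoc] at h3
    have hmB := mem_of_add_mem_left h3 h1
    have hqB := mem_of_add_mem_right h2 hmB
    exact hqJ (eq_zero_of_mem_disjoint hAB hqA hqB ▸ zero_mem _)
  rintro ⟨A, B, hA, hB, hAB, hsub⟩
  rcases hsub q (hX q hq hqN) hq with h | h
  · exact key A B hA hAB hsub h
  · exact key B A hB hAB.symm (fun x hx hxQ => (hsub x hx hxQ).symm) h

/-- In dimension at least four, a set and its complement do not both split. -/
theorem not_splits_of_splits {X Y : Set V} {K : Submodule (ZMod 2) V}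
    (hXY : ∀ x, x ≠ 0 → x ∈ X ∨ x ∈ Y) (hK : 4 ≤ finrank (ZMod 2) K) (hY : Splits Y K) :
    ¬ Splits X K := by
  obtain ⟨A, B, hA, hB, hAB, hsub⟩ := hY
  have hXsub : ∀ x ∈ K, x ∉ A → x ∉ B → x ∈ X := fun x hx hxA hxB =>
    (hXY x (by rintro rfl; exact hxA (zero_mem _))).resolve_right fun h => by
      rcases hsub x h hx with h | h <;> contradiction
  -- In dimension three the result fails: a basis and its complement, a line and a point, both
  -- split.
  by_cases hsup : K ≤ A ⊔ B
  swap
  · exact not_splits_of_diff hsup (by omega) fun x hx hxN =>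
      hXsub x hx (fun h => hxN (mem_sup_left h)) fun h => hxN (mem_sup_right h)
  have hA0 : A ≠ ⊥ := by rintro rfl; exact hB.not_ge (by simpa using hsup)
  have hB0 : B ≠ ⊥ := by rintro rfl; exact hA.not_ge (by simpa using hsup)
  have key : ∀ C D : Submodule (ZMod 2) V, C < K → D < K → Disjoint C D →
      (∀ x ∈ X, x ∈ K → x ∈ C ∨ x ∈ D) → finrank (ZMod 2) D ≤ finrank (ZMod 2) C → False := by
    intro C D hC hD hCD hsub' hle
    have hCDK : finrank (ZMod 2) C + finrank (ZMod 2) D ≤ finrank (ZMod 2) K := by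
      have h1 := Submodule.finrank_sup_add_finrank_inf_eq C D
      rw [hCD.eq_bot, finrank_bot] at h1
      have h2 := Submodule.finrank_mono (sup_le hC.le hD.le)
      omega
    -- J is to cut both A and B, so that their traces span only codimension two in K, and X contains
    -- the rest of K ⊓ J and does not split there. If C has codimension one, J must also differ from
    -- it on K, whence N = C.
    obtain ⟨N, hN2, hNK, hCN⟩ : ∃ N : Submodule (ZMod 2) V, 2 ≤ finrank (ZMod 2) N ∧ N ≤ K ∧
        (C = N ∨ finrank (ZMod 2) C + 1 < finrank (ZMod 2) K) := by
      by_cases h : 2 ≤ finrank (ZMod 2) C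
      · exact ⟨C, h, hC.le, Or.inl rfl⟩
      · exact ⟨K, by omega, le_rfl, Or.inr (by omega)⟩
    obtain ⟨J, hJ, hAJ, hBJ, hNJ⟩ := exists_isHyper_not_le_three hA0 hB0 hN2
    have hKJ := hJ.finrank_inf (U := K) fun h => hAJ (hA.le.trans h)
    have hAJ' := hJ.finrank_inf hAJ
    have hBJ' := hJ.finrank_inf hBJ
    have hABK : finrank (ZMod 2) A + finrank (ZMod 2) B ≤ finrank (ZMod 2) K := by
      have h1 := Submodule.finrank_sup_add_finrank_inf_eq A B
      rw [hAB.eq_bot, finrank_bot] at h1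
      have h2 := Submodule.finrank_mono (sup_le hA.le hB.le)
      omega
    refine not_splits_of_diff (X := X) (N := (A ⊓ J) ⊔ (B ⊓ J)) (Q := K ⊓ J) ?_ (by omega) ?_
      (Splits.of_le hCD (fun x hx hxK => hsub' x hx hxK.1) ?_ ?_)
    · intro h
      have h1 := Submodule.finrank_mono h
      have h2 := Submodule.finrank_add_le_finrank_add_finrank (A ⊓ J) (B ⊓ J)
      omega
    · intro x hx hxN
      exact hXsub x hx.1 (fun h => hxN (mem_sup_left ⟨h, hx.2⟩))
        fun h => hxN (mem_sup_right ⟨h, hx.2⟩)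
    · intro h
      have h1 := Submodule.finrank_mono h
      have h2 := Submodule.finrank_lt_finrank_of_lt hC
      rcases hCN with rfl | h3
      · have := Submodule.eq_of_le_of_finrank_eq h (by omega)
        exact hNJ (this ▸ inf_le_right)
      · omega
    · intro h
      have h1 := Submodule.finrank_mono h
      omega
  rintro ⟨C, D, hC, hD, hCD, hsub'⟩
  rcases le_total (finrank (ZMod 2) D) (finrank (ZMod 2) C) with h | h
  · exact key C D hC hD hCD hsub' h
  · exact key D C hD hC hCD.symm (fun x hx hxK => (hsub' x hx hxK).symm) h

end Split


/-! ### Circuits, links and their chords. -/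

section Circuit

open Module Submodule

variable {V : Type*} [AddCommGroup V] [Module (ZMod 2) V]

/-- A finite set of vectors over `GF(2)` that is a circuit: its sum is zero, and no proper nonempty
subset has sum zero. -/
structure IsSumCircuit (Y : Finset V) : Prop where
  nonempty : Y.Nonempty
  sum_eq_zero : ∑ y ∈ Y, y = 0
  minimal : ∀ Z ⊆ Y, ∑ z ∈ Z, z = 0 → Z = ∅ ∨ Z = Y

/-- The elements of the circuit in A and the others have the same sum, which lies in both parts and
is therefore zero; minimality puts the whole circuit in one part. -/
theorem IsSumCircuit.not_splits {X : Set V} {Y : Finset V} (hY : IsSumCircuit Y)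
    (hYX : (Y : Set V) ⊆ X) : ¬ Splits X (span (ZMod 2) Y) := by
  classical
  rintro ⟨A, B, hA, hB, hAB, hsub⟩
  have hZY : Y.filter (· ∈ A) ⊆ Y := Finset.filter_subset _ _
  have hZA : ∑ d ∈ Y.filter (· ∈ A), d ∈ A := sum_mem fun d hd => (Finset.mem_filter.1 hd).2
  have hB' : ∀ d ∈ Y, d ∉ Y.filter (· ∈ A) → d ∈ B := fun d hd hd' =>
    (hsub d (hYX hd) (subset_span hd)).resolve_left fun h => hd' (Finset.mem_filter.2 ⟨hd, h⟩)
  have hZB : ∑ d ∈ Y.filter (· ∈ A), d ∈ B := by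
    have : ∑ d ∈ Y \ Y.filter (· ∈ A), d ∈ B := sum_mem fun d hd => by
      have hd' := Finset.mem_sdiff.1 hd
      exact hB' d hd'.1 hd'.2
    rwa [sum_sdiff_eq_add hZY, hY.sum_eq_zero, zero_add] at this
  rcases hY.minimal _ hZY (eq_zero_of_mem_disjoint hAB hZA hZB) with h | h
  · exact hB.not_ge (span_le.2 fun d hd => hB' d hd (by rw [h]; simp))
  · refine hA.not_ge (span_le.2 fun d hd => ?_)
    have hd' : d ∈ Y.filter (· ∈ A) := by rw [h]; exact hd
    exact (Finset.mem_filter.1 hd').2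

/-- If the sum were in Y, removing it from Z or adding it to Z would give a proper nonempty subset
with sum zero. The two bounds on the size are for these two cases. -/
theorem IsSumCircuit.sum_notMem [DecidableEq V] {Y Z : Finset V} (hY : IsSumCircuit Y)
    (hZ : Z ⊆ Y) (h2 : 2 ≤ Z.card) (h : Z.card + 1 < Y.card) : ∑ z ∈ Z, z ∉ Y := by
  intro hmem
  by_cases hz : ∑ z ∈ Z, z ∈ Z
  · have h0 : ∑ d ∈ Z \ {∑ z ∈ Z, z}, d = 0 := by
      rw [sum_sdiff_eq_add (Finset.singleton_subset_iff.2 hz), Finset.sum_singleton,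
        ZModModule.add_self]
    have hc := Finset.card_sdiff_of_subset (Finset.singleton_subset_iff.2 hz)
    rw [Finset.card_singleton] at hc
    rcases hY.minimal _ (Finset.sdiff_subset.trans hZ) h0 with h1 | h1
    · rw [h1, Finset.card_empty] at hc; omega
    · rw [h1] at hc; omega
  · have h0 : ∑ d ∈ insert (∑ z ∈ Z, z) Z, d = 0 := by
      rw [Finset.sum_insert hz, ZModModule.add_self]
    have hc := Finset.card_insert_of_notMem hz
    rcases hY.minimal _ (Finset.insert_subset hmem hZ) h0 with h1 | h1
    · rw [h1, Finset.card_empty] at hc; omega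
    · rw [h1] at hc; omega

/-- Sums of two or three circuit elements lie in the complement; for triples this needs five
elements. If one pair sum is in A, the triangles force all of them there. Then no element of Y is in
A, so triple sums lie in B, and two of them differ by a pair sum. -/
theorem IsSumCircuit.not_splits_compl {X : Set V} {Y : Finset V} (hY : IsSumCircuit Y)
    (h5 : 5 ≤ Y.card) (hX : ∀ x ∈ span (ZMod 2) (Y : Set V), x ≠ 0 → x ∉ Y → x ∈ X) :
    ¬ Splits X (span (ZMod 2) Y) := by
  classical
  rintro ⟨A, B, hA, hB, hAB, hsub⟩
  have hs : ∀ Z ⊆ Y, 2 ≤ Z.card → Z.card ≤ 3 → ∑ z ∈ Z, z ∈ A ∨ ∑ z ∈ Z, z ∈ B := by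
    intro Z hZ h2 h3
    have hsp : ∑ z ∈ Z, z ∈ span (ZMod 2) (Y : Set V) :=
      sum_mem fun z hz => subset_span (hZ hz)
    refine hsub _ (hX _ hsp ?_ (hY.sum_notMem hZ h2 (by omega))) hsp
    intro h0
    rcases hY.minimal Z hZ h0 with h | h
    · simp [h] at h2
    · rw [h] at h3; omega
  have hs2 : ∀ a ∈ Y, ∀ b ∈ Y, a ≠ b → a + b ∈ A ∨ a + b ∈ B := by
    intro a ha b hb hab
    have := hs {a, b} (by simp [Finset.insert_subset_iff, ha, hb])
      (by rw [Finset.card_pair hab]) (by rw [Finset.card_pair hab]; omega)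
    rwa [Finset.sum_pair hab] at this
  have hs3 : ∀ a ∈ Y, ∀ b ∈ Y, ∀ c ∈ Y, a ≠ b → a ≠ c → b ≠ c →
      a + b + c ∈ A ∨ a + b + c ∈ B := by
    intro a ha b hb c hc hab hac hbc
    have hcard : ({a, b, c} : Finset V).card = 3 := Finset.card_eq_three.2 ⟨a, b, c, hab, hac, hbc, rfl⟩
    have := hs {a, b, c} (by simp [Finset.insert_subset_iff, ha, hb, hc]) (by omega) (by omega)
    rwa [Finset.sum_insert (by simp [hab, hac]), Finset.sum_pair hbc, ← add_assoc] at this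
  obtain ⟨a, b, c, ha, hb, hc, hab, hac, hbc⟩ :=
    Finset.two_lt_card_iff.1 (show 2 < Y.card by omega)
  obtain ⟨d, hd⟩ : (Y \ {a, b, c}).Nonempty := by
    rw [← Finset.card_pos]
    have h1 := Finset.le_card_sdiff {a, b, c} Y
    have h2 := Finset.card_le_three (a := a) (b := b) (c := c)
    omega
  simp only [Finset.mem_sdiff, Finset.mem_insert, Finset.mem_singleton, not_or] at hd
  obtain ⟨hd, hda, hdb, hdc⟩ := hd
  have key : ∀ A B : Submodule (ZMod 2) V, A < span (ZMod 2) (Y : Set V) → Disjoint A B →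
      (∀ a ∈ Y, ∀ b ∈ Y, a ≠ b → a + b ∈ A ∨ a + b ∈ B) →
      (∀ a ∈ Y, ∀ b ∈ Y, ∀ c ∈ Y, a ≠ b → a ≠ c → b ≠ c → a + b + c ∈ A ∨ a + b + c ∈ B) →
      a + b ∈ A → False := by
    intro A B hA hAB hs2 hs3 habA
    have hne : ∀ x y : V, x ≠ y → x + y ∈ A → x + y ∈ B → False := fun x y hxy h1 h2 =>
      hxy (add_eq_zero_iff_eq_of_zmodTwo.1 (eq_zero_of_mem_disjoint hAB h1 h2))
    have h1 : ∀ x ∈ Y, a ≠ x → a + x ∈ A := by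
      intro x hx hax
      by_cases hbx : b = x
      · rwa [← hbx]
      refine (hs2 a ha x hx hax).resolve_right fun hB => ?_
      rcases hs2 b hb x hx hbx with h | h
      · refine hne a x hax ?_ hB
        have := A.add_mem habA h
        rwa [add_assoc, ← add_assoc b, ZModModule.add_self, zero_add] at this
      · refine hne a b hab habA ?_
        have := B.add_mem hB h
        rwa [add_comm b x, add_assoc, ← add_assoc x, ZModModule.add_self, zero_add] at this
    have h2 : ∀ x ∈ Y, ∀ y ∈ Y, x + y ∈ A := by
      have h3 : ∀ x ∈ Y, a + x ∈ A := fun x hx => by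
        by_cases hax : a = x
        · rw [← hax, ZModModule.add_self]; exact zero_mem _
        · exact h1 x hx hax
      intro x hx y hy
      have := A.add_mem (h3 x hx) (h3 y hy)
      rwa [add_comm a x, add_assoc, ← add_assoc a, ZModModule.add_self, zero_add] at this
    have h3 : ∀ x ∈ Y, x ∉ A := by
      intro x hx hxA
      exact hA.not_ge (span_le.2 fun y hy => mem_of_add_mem_left (h2 x hx y hy) hxA)
    have h4 : ∀ x ∈ Y, a ≠ x → b ≠ x → a + b + x ∈ B := fun x hx hax hbx =>
      (hs3 a ha b hb x hx hab hax hbx).resolve_left fun h =>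
        h3 x hx (mem_of_add_mem_left h habA)
    have h5 := B.add_mem (h4 c hc hac hbc) (h4 d hd (Ne.symm hda) (Ne.symm hdb))
    refine hne c d (Ne.symm hdc) (h2 c hc d hd) ?_
    rwa [add_comm (a + b) c, add_assoc, ← add_assoc (a + b), ZModModule.add_self,
      zero_add] at h5
  rcases hs2 a ha b hb hab with h | h
  · exact key A B hA hAB hs2 hs3 h
  · exact key B A hB hAB.symm (fun x hx y hy hxy => (hs2 x hx y hy hxy).symm)
      (fun x hx y hy z hz h1 h2 h3 => (hs3 x hx y hy z hz h1 h2 h3).symm) h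

/-- A finite subset `D` of `X` outside the subspace `U` whose sum is a nonzero vector of `U`. -/
structure IsLink (X : Set V) (U : Submodule (ZMod 2) V) (D : Finset V) : Prop where
  subset : (D : Set V) ⊆ X
  notMem : ∀ d ∈ D, d ∉ U
  sum_mem : ∑ d ∈ D, d ∈ U
  sum_ne : ∑ d ∈ D, d ≠ 0

/-- Without a link, `U` and the span of the rest of `X` are disjoint, and they split `X`. -/
theorem exists_isLink {X : Set V} {U : Submodule (ZMod 2) V} (hX : ¬ Splits X ⊤) (hU : U ≠ ⊥)
    (hU' : U ≠ ⊤) : ∃ D, IsLink X U D := by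
  by_contra! hcon
  refine hX ⟨U, span (ZMod 2) (X \ U), lt_top_iff_ne_top.2 hU', ?_, ?_, fun x hx _ => ?_⟩
  rotate_left
  · rw [Submodule.disjoint_def]
    intro x hxU hx
    obtain ⟨D, hD, rfl⟩ := mem_span_iff_exists_sum.1 hx
    by_contra h0
    exact hcon D ⟨fun d hd => (hD hd).1, fun d hd => (hD hd).2, hxU, h0⟩
  · by_cases hxU : x ∈ U
    · exact Or.inl hxU
    · exact Or.inr (subset_span ⟨hx, hxU⟩)
  · rw [lt_top_iff_ne_top]
    intro htop
    obtain ⟨x, hxU, hx0⟩ := Submodule.exists_mem_ne_zero_of_ne_bot hU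
    obtain ⟨D, hD, rfl⟩ := mem_span_iff_exists_sum.1 (htop ▸ mem_top : x ∈ span (ZMod 2) (X \ U))
    exact hcon D ⟨fun d hd => (hD hd).1, fun d hd => (hD hd).2, hxU, hx0⟩

/-- A link of smallest size. -/
structure IsMinLink (X : Set V) (U : Submodule (ZMod 2) V) (D : Finset V) : Prop
    extends IsLink X U D where
  card_le : ∀ D', IsLink X U D' → D.card ≤ D'.card

theorem exists_isMinLink {X : Set V} {U : Submodule (ZMod 2) V} (hX : ¬ Splits X ⊤) (hU : U ≠ ⊥)
    (hU' : U ≠ ⊤) : ∃ D, IsMinLink X U D := by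
  classical
  have h : ∃ n, ∃ D, IsLink X U D ∧ D.card = n := by
    obtain ⟨D, hD⟩ := exists_isLink hX hU hU'
    exact ⟨_, D, hD, rfl⟩
  obtain ⟨D, hD, hn⟩ := Nat.find_spec h
  exact ⟨D, hD, fun D' hD' => hn ▸ Nat.find_min' h ⟨D', hD', rfl⟩⟩

/-- Either `Z` itself or its complement in `D` is a link, according to whether its sum is nonzero.
-/
theorem IsMinLink.eq_empty_or_eq {X : Set V} {U : Submodule (ZMod 2) V} {D Z : Finset V}
    (hD : IsMinLink X U D) (hZ : Z ⊆ D) (hZU : ∑ d ∈ Z, d ∈ U) : Z = ∅ ∨ Z = D := by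
  classical
  by_cases h0 : ∑ d ∈ Z, d = 0
  · left
    have h1 : D.card ≤ (D \ Z).card := by
      have hs := sum_sdiff_eq_add hZ
      rw [h0, add_zero] at hs
      exact hD.card_le _ ⟨fun d hd => hD.subset (Finset.sdiff_subset hd),
        fun d hd => hD.notMem d (Finset.sdiff_subset hd), hs ▸ hD.sum_mem, hs ▸ hD.sum_ne⟩
    have h2 := Finset.eq_of_subset_of_card_le Finset.sdiff_subset h1
    rwa [Finset.sdiff_eq_self_iff_disjoint, disjoint_comm,
      Finset.disjoint_iff_inter_eq_empty, Finset.inter_eq_left.2 hZ] at h2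
  · right
    exact Finset.eq_of_subset_of_card_le hZ (hD.card_le _ ⟨fun d hd => hD.subset (hZ hd),
      fun d hd => hD.notMem d (hZ hd), hZU, h0⟩)

/-- Modulo U, a further point g is a sum over some A ⊆ D, and also over D \ A. One of these choices,
together with g, is a link; by minimality it omits at most one element d of D, and then either g ∈ U
or {g, d} is a link smaller than D. -/
theorem IsMinLink.mem_of_notMem {X : Set V} {U : Submodule (ZMod 2) V} {D : Finset V}
    (hD : IsMinLink X U D) (h3 : 3 ≤ D.card) (htop : U ⊔ span (ZMod 2) D = ⊤) {g : V}
    (hg : g ∈ X) (hgU : g ∉ U) : g ∈ D := by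
  classical
  by_contra hgD
  have key : ∀ A ⊆ D, g + ∑ a ∈ A, a ∈ U → g + ∑ a ∈ A, a ≠ 0 → False := by
    intro A hA hAU hA0
    have hgA : g ∉ A := fun h => hgD (hA h)
    have hc : D.card ≤ A.card + 1 := by
      rw [← Finset.card_insert_of_notMem hgA]
      refine hD.card_le _ ⟨fun d hd => ?_, fun d hd => ?_, ?_, ?_⟩
      · rcases Finset.mem_insert.1 hd with rfl | h
        exacts [hg, hD.subset (hA h)]
      · rcases Finset.mem_insert.1 hd with rfl | h
        exacts [hgU, hD.notMem d (hA h)]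
      · rwa [Finset.sum_insert hgA]
      · rwa [Finset.sum_insert hgA]
    have hcs := Finset.card_sdiff_of_subset hA
    have hs := sum_sdiff_eq_add hA
    have hgs : g + ∑ d ∈ D \ A, d ∈ U := by
      rw [hs, add_comm (∑ d ∈ D, d), ← add_assoc]; exact U.add_mem hAU hD.sum_mem
    rcases Nat.lt_or_ge (D \ A).card 1 with h | h
    · rw [Finset.card_eq_zero.1 (Nat.lt_one_iff.1 h)] at hgs
      exact hgU (by simpa using hgs)
    · obtain ⟨d, hd⟩ := Finset.card_eq_one.1 (show (D \ A).card = 1 by omega)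
      have hdD : d ∈ D := Finset.sdiff_subset (hd ▸ Finset.mem_singleton_self d)
      have hgd : g ≠ d := fun h => hgD (h ▸ hdD)
      rw [hd, Finset.sum_singleton] at hgs
      have := hD.card_le {g, d} ⟨fun x hx => ?_, fun x hx => ?_, ?_, ?_⟩
      · rw [Finset.card_pair hgd] at this; omega
      · rcases Finset.mem_insert.1 hx with rfl | h
        · exact hg
        · exact hD.subset (Finset.mem_singleton.1 h ▸ hdD)
      · rcases Finset.mem_insert.1 hx with rfl | h
        · exact hgU
        · exact hD.notMem x (Finset.mem_singleton.1 h ▸ hdD)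
      · rwa [Finset.sum_pair hgd]
      · rw [Finset.sum_pair hgd]
        exact fun h => hgd (add_eq_zero_iff_eq_of_zmodTwo.1 h)
  have hgtop : g ∈ U ⊔ span (ZMod 2) (D : Set V) := htop ▸ mem_top
  obtain ⟨u, hu, y, hy, huy⟩ := Submodule.mem_sup.1 hgtop
  obtain ⟨A, hA, rfl⟩ := mem_span_iff_exists_sum.1 hy
  have hA' : A ⊆ D := by exact_mod_cast hA
  have hgA : g + ∑ a ∈ A, a = u := by
    rw [← huy, add_assoc, ZModModule.add_self, add_zero]
  by_cases hu0 : u = 0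
  · have hs := sum_sdiff_eq_add hA'
    have h1 : g + ∑ a ∈ D \ A, a = ∑ d ∈ D, d := by
      rw [hs, add_comm (∑ d ∈ D, d), ← add_assoc, hgA, hu0, zero_add]
    exact key (D \ A) Finset.sdiff_subset (h1 ▸ hD.sum_mem) (h1 ▸ hD.sum_ne)
  · exact key A hA' (hgA ▸ hu) (hgA ▸ hu0)

/-- A smallest link together with a smallest representation of its sum inside `U` is a circuit
without chords. -/
theorem IsMinLink.isSumCircuit_union [DecidableEq V] {X : Set V} {U : Submodule (ZMod 2) V}
    {C D : Finset V} (hD : IsMinLink X U D) (hX : ∀ g ∈ X, g ∉ U → g ∈ D)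
    (hCU : ∀ c ∈ C, c ∈ U)
    (hCX : (C : Set V) ⊆ X) (hCs : ∑ c ∈ C, c = ∑ d ∈ D, d)
    (hC : ∀ C' : Finset V, (∀ c ∈ C', c ∈ X ∧ c ∈ U) → ∑ c ∈ C', c = ∑ d ∈ D, d →
      C.card ≤ C'.card) :
    IsSumCircuit (C ∪ D) ∧ (C ∪ D).card = C.card + D.card ∧
      ∀ x ∈ X, x ≠ 0 → x ∈ span (ZMod 2) ((C ∪ D : Finset V) : Set V) → x ∈ C ∪ D := by
  have hdisj : Disjoint C D := Finset.disjoint_left.2 fun x hx hx' => hD.notMem x hx' (hCU x hx)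
  have hsplit : ∀ Z ⊆ C ∪ D, ∑ z ∈ Z, z ∈ U →
      ∃ Z₁ ⊆ C, (Z = Z₁ ∨ Z = Z₁ ∪ D) := by
    classical
    intro Z hZ hZU
    have h1 : ∑ z ∈ Z.filter (· ∈ U), z ∈ U := sum_mem fun d hd => (Finset.mem_filter.1 hd).2
    have h2 : ∑ z ∈ Z.filter (· ∉ U), z ∈ U := by
      rw [← Finset.sum_filter_add_sum_filter_not Z (· ∈ U)] at hZU
      exact mem_of_add_mem_left hZU h1
    have h3 : Z.filter (· ∈ U) ⊆ C := fun z hz => by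
      obtain ⟨hz1, hz2⟩ := Finset.mem_filter.1 hz
      exact (Finset.mem_union.1 (hZ hz1)).resolve_right fun h => hD.notMem z h hz2
    have h4 : Z.filter (· ∉ U) ⊆ D := fun z hz => by
      obtain ⟨hz1, hz2⟩ := Finset.mem_filter.1 hz
      exact (Finset.mem_union.1 (hZ hz1)).resolve_left fun h => hz2 (hCU z h)
    have h5 := Finset.filter_union_filter_not_eq (· ∈ U) Z
    refine ⟨_, h3, (hD.eq_empty_or_eq h4 h2).imp (fun h => ?_) fun h => ?_⟩
    · rw [h, Finset.union_empty] at h5; exact h5.symm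
    · rw [h] at h5; exact h5.symm
  have hsub : ∀ Z ⊆ C, ∑ z ∈ Z, z = 0 → Z = ∅ := by
    intro Z hZ h0
    have h1 := hC (C \ Z) (fun c hc => ⟨hCX (Finset.sdiff_subset hc),
      hCU c (Finset.sdiff_subset hc)⟩) (by rw [sum_sdiff_eq_add hZ, h0, add_zero, hCs])
    have h2 := Finset.eq_of_subset_of_card_le Finset.sdiff_subset h1
    rwa [Finset.sdiff_eq_self_iff_disjoint, disjoint_comm,
      Finset.disjoint_iff_inter_eq_empty, Finset.inter_eq_left.2 hZ] at h2
  have hsumU : ∀ Z ⊆ C, ∑ z ∈ Z, z + ∑ d ∈ D, d = ∑ z ∈ C \ Z, z := by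
    intro Z hZ
    rw [sum_sdiff_eq_add hZ, hCs, add_comm]
  have hdj : ∀ Z ⊆ C, Disjoint Z D := fun Z hZ => Finset.disjoint_of_subset_left hZ hdisj
  refine ⟨⟨?_, ?_, ?_⟩, Finset.card_union_of_disjoint hdisj, ?_⟩
  · rw [Finset.nonempty_iff_ne_empty]
    intro h
    have h1 : D = ∅ := Finset.subset_empty.1 (h ▸ Finset.subset_union_right)
    exact hD.sum_ne (by simp [h1])
  · rw [Finset.sum_union hdisj, hCs, ZModModule.add_self]
  · intro Z hZ h0
    obtain ⟨Z₁, hZ₁, rfl | rfl⟩ := hsplit Z hZ (h0 ▸ zero_mem _)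
    · exact Or.inl (hsub _ hZ₁ h0)
    · right
      rw [Finset.sum_union (hdj _ hZ₁), hsumU _ hZ₁] at h0
      have h1 := hsub _ Finset.sdiff_subset h0
      rw [Finset.sdiff_eq_empty_iff_subset] at h1
      rw [Finset.Subset.antisymm hZ₁ h1]
  · intro x hx hx0 hxs
    by_cases hxU : x ∈ U
    swap
    · exact Finset.mem_union_right _ (hX x hx hxU)
    obtain ⟨Z, hZ, rfl⟩ := mem_span_iff_exists_sum.1 hxs
    -- A vector of U in the span is a sum over a subset W of C alone. If it belongs to X, trading W
    -- for it shortens C unless W is a single element.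
    obtain ⟨W, hW, hWs⟩ : ∃ W ⊆ C, ∑ z ∈ Z, z = ∑ z ∈ W, z := by
      obtain ⟨Z₁, hZ₁, rfl | rfl⟩ := hsplit Z (by exact_mod_cast hZ) hxU
      · exact ⟨_, hZ₁, rfl⟩
      · exact ⟨_, Finset.sdiff_subset, by rw [Finset.sum_union (hdj _ hZ₁), hsumU _ hZ₁]⟩
    rw [hWs] at hx hx0 hxU ⊢
    apply Finset.mem_union_left
    by_contra hxC
    have hxW : ∑ z ∈ W, z ∉ C \ W := fun h => hxC (Finset.sdiff_subset h)
    have h1 := hC (insert (∑ z ∈ W, z) (C \ W)) (fun c hc => by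
      rcases Finset.mem_insert.1 hc with rfl | h
      · exact ⟨hx, hxU⟩
      · exact ⟨hCX (Finset.sdiff_subset h), hCU c (Finset.sdiff_subset h)⟩) (by
      rw [Finset.sum_insert hxW, sum_sdiff_eq_add hW, add_comm, add_assoc, ZModModule.add_self,
        add_zero, hCs])
    rw [Finset.card_insert_of_notMem hxW, Finset.card_sdiff_of_subset hW] at h1
    have h2 := Finset.card_le_card hW
    have h3 : W.card ≤ 1 := by omega
    have h4 : 0 < W.card := by
      rw [Finset.card_pos, Finset.nonempty_iff_ne_empty]
      rintro rfl
      simp at hx0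
    obtain ⟨c, rfl⟩ := Finset.card_eq_one.1 (le_antisymm h3 h4)
    exact hxC (by simpa using hW)

variable [FiniteDimensional (ZMod 2) V]

/-- One element of `D` is redundant modulo `U`, because the sum of `D` lies in `U`. -/
theorem IsLink.finrank_lt {X : Set V} {U : Submodule (ZMod 2) V} {D : Finset V}
    (hD : IsLink X U D) (htop : U ⊔ span (ZMod 2) D = ⊤) :
    finrank (ZMod 2) V < finrank (ZMod 2) U + D.card := by
  classical
  obtain ⟨d, hd⟩ : D.Nonempty := by
    rw [Finset.nonempty_iff_ne_empty]; rintro rfl; exact hD.sum_ne (by simp)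
  have h1 : U ⊔ span (ZMod 2) ((D.erase d : Finset V) : Set V) = ⊤ := by
    rw [eq_top_iff, ← htop]
    refine sup_le le_sup_left (span_le.2 fun x hx => ?_)
    by_cases hxd : x = d
    · have h2 := Finset.add_sum_erase D id hd
      simp only [id] at h2
      subst hxd
      refine mem_of_add_mem_right (y := ∑ y ∈ D.erase x, y) (h2 ▸ mem_sup_left hD.sum_mem) ?_
      exact mem_sup_right (Submodule.sum_mem _ fun y hy => subset_span hy)
    · exact mem_sup_right (subset_span (Finset.mem_coe.2 (Finset.mem_erase.2 ⟨hxd, hx⟩)))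
  have h2 := Submodule.finrank_add_le_finrank_add_finrank U
    (span (ZMod 2) ((D.erase d : Finset V) : Set V))
  rw [h1, finrank_top] at h2
  have h3 := finrank_span_finset_le_card (R := ZMod 2) (D.erase d)
  have h4 := Finset.card_erase_of_mem hd
  have h5 := Finset.card_pos.2 ⟨d, hd⟩
  simp only [Set.finrank] at h3
  omega

/-- Inside a subspace of dimension at least four in which the complement of `X` splits there is
a hyperplane through a given point of `X` in which `X` does not split. -/
theorem exists_isHyper_not_splits {X Y : Set V} {U : Submodule (ZMod 2) V}
    (hXY : ∀ x, x ≠ 0 → x ∈ X ∨ x ∈ Y) (hU : 4 ≤ finrank (ZMod 2) U) (hY : Splits Y U) {w : V}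
    (hwX : w ∈ X) :
    ∃ J, IsHyper J ∧ w ∈ J ∧ ¬ U ≤ J ∧ ¬ Splits X (U ⊓ J) := by
  have hw1 : finrank (ZMod 2) (span (ZMod 2) {w}) ≤ 1 := by
    have h2 := finrank_span_le_card (R := ZMod 2) ({w} : Set V)
    simpa using h2
  have hUw : ¬ U ≤ span (ZMod 2) {w} := fun h => by
    have := Submodule.finrank_mono h; omega
  have key : ∀ A B : Submodule (ZMod 2) V, A < U → B < U → Disjoint A B →
      (∀ x ∈ Y, x ∈ U → x ∈ A ∨ x ∈ B) → A ≤ span (ZMod 2) {w} →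
      ∃ J, IsHyper J ∧ w ∈ J ∧ ¬ U ≤ J ∧ ¬ Splits X (U ⊓ J) := by
    intro A B hA hB hAB hsub hAw
    have hsub' : ∀ x ∈ U, x ∉ B → x ∈ X := by
      intro x hx hxB
      have hx0 : x ≠ 0 := by rintro rfl; exact hxB (zero_mem _)
      rcases hXY x hx0 with h | h
      · exact h
      · rcases mem_span_singleton_zmodTwo (hAw ((hsub x h hx).resolve_right hxB)) with h | h
        · exact absurd h hx0
        · exact h ▸ hwX
    -- J must not meet U exactly in B. Not containing B ensures this; if B lies in the span of w,
    -- its dimension does.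
    obtain ⟨L, hL, hBL⟩ : ∃ L : Submodule (ZMod 2) V, ¬ L ≤ span (ZMod 2) {w} ∧
        (B = L ∨ finrank (ZMod 2) B ≤ 1) := by
      by_cases h : B ≤ span (ZMod 2) {w}
      · exact ⟨U, hUw, Or.inr ((Submodule.finrank_mono h).trans hw1)⟩
      · exact ⟨B, h, Or.inl rfl⟩
    obtain ⟨J, hJ, hwJ, hUJ, hLJ⟩ := exists_isHyper_not_le_not_le hUw hL
    have hfr := hJ.finrank_inf hUJ
    refine ⟨J, hJ, hwJ (mem_span_singleton_self w), hUJ,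
      not_splits_of_diff (N := B) (fun h => ?_) (by omega) fun x hx => hsub' x hx.1⟩
    have h1 := Submodule.finrank_mono h
    have h2 := Submodule.finrank_lt_finrank_of_lt hB
    rcases hBL with rfl | h3
    · exact hLJ (Submodule.eq_of_le_of_finrank_eq h (by omega) ▸ inf_le_right)
    · omega
  obtain ⟨A, B, hA, hB, hAB, hsub⟩ := hY
  by_cases hAw : A ≤ span (ZMod 2) {w}
  · exact key A B hA hB hAB hsub hAw
  by_cases hBw : B ≤ span (ZMod 2) {w}
  · exact key B A hB hA hAB.symm (fun x hx hxU => (hsub x hx hxU).symm) hBw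
  obtain ⟨J, hJ, hwJ, hAJ, hBJ⟩ := exists_isHyper_not_le_not_le hAw hBw
  have hUJ : ¬ U ≤ J := fun h => hAJ (hA.le.trans h)
  have h1 := hJ.finrank_inf hUJ
  have h2 := hJ.finrank_inf hAJ
  have h3 := hJ.finrank_inf hBJ
  refine ⟨J, hJ, hwJ (mem_span_singleton_self w), hUJ,
    not_splits_of_diff (N := (A ⊓ J) ⊔ (B ⊓ J)) (fun h => ?_) (by omega) ?_⟩
  · have h4 := Submodule.finrank_mono h
    have h5 := Submodule.finrank_add_le_finrank_add_finrank (A ⊓ J) (B ⊓ J)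
    have h6 := Submodule.finrank_sup_add_finrank_inf_eq A B
    rw [hAB.eq_bot, finrank_bot] at h6
    have h7 := Submodule.finrank_mono (sup_le hA.le hB.le)
    omega
  · intro x hx hxN
    refine (hXY x (by rintro rfl; exact hxN (zero_mem _))).resolve_right fun h => ?_
    rcases hsub x h hx.1 with h | h
    · exact hxN (mem_sup_left ⟨h, hx.2⟩)
    · exact hxN (mem_sup_right ⟨h, hx.2⟩)

end Circuit


/-! ### Critical partitions in dimension at least six. -/

section Critical

open Module Submodule

variable {V : Type*} [AddCommGroup V] [Module (ZMod 2) V] [FiniteDimensional (ZMod 2) V]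

/-- If every hyperplane splits, then a critical set of vectors is a circuit. -/
theorem exists_isSumCircuit_of_isHyper_splits {X Y : Set V} (hr : 6 ≤ finrank (ZMod 2) V)
    (hXY : ∀ x, x ≠ 0 → x ∈ X ∨ x ∈ Y) (h0 : (0 : V) ∉ X) (hX : ¬ Splits X ⊤)
    (hcrit : ∀ U : Submodule (ZMod 2) V, U ≠ ⊥ → U ≠ ⊤ → Splits X U ∨ Splits Y U)
    (hhyp : ∀ J : Submodule (ZMod 2) V, IsHyper J → Splits X J) :
    ∃ C : Finset V, (C : Set V) = X ∧ IsSumCircuit C := by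
  classical
  obtain ⟨U, ⟨hU0, hUt, hUX⟩, hUmax⟩ : ∃ U : Submodule (ZMod 2) V,
      (U ≠ ⊥ ∧ U ≠ ⊤ ∧ ¬ Splits X U) ∧ ∀ T : Submodule (ZMod 2) V,
        (T ≠ ⊥ ∧ T ≠ ⊤ ∧ ¬ Splits X T) → U ≤ T → T = U := by
    obtain ⟨x, hx⟩ : ∃ x, x ∈ X := by
      by_contra! hcon
      have : (⊥ : Submodule (ZMod 2) V) < ⊤ := by
        rw [lt_top_iff_ne_top]
        intro h
        have h1 := finrank_top (ZMod 2) V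
        rw [← h, finrank_bot] at h1; omega
      exact hX ⟨⊥, ⊥, this, this, disjoint_bot_left, fun x hx => absurd hx (hcon x)⟩
    have hx0 : x ≠ 0 := by rintro rfl; exact h0 hx
    have hS : span (ZMod 2) {x} ≠ ⊥ ∧ span (ZMod 2) {x} ≠ ⊤ ∧ ¬ Splits X (span (ZMod 2) {x}) := by
      refine ⟨by simpa using hx0, fun h => ?_, ?_⟩
      · have h2 := finrank_span_le_card (R := ZMod 2) ({x} : Set V)
        rw [h, finrank_top] at h2
        simp at h2; omega
      · rintro ⟨A, B, hA, hB, -, hsub⟩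
        rcases hsub x hx (mem_span_singleton_self x) with h | h
        · exact hA.not_ge ((span_singleton_le_iff_mem _ _).2 h)
        · exact hB.not_ge ((span_singleton_le_iff_mem _ _).2 h)
    obtain ⟨U, hU, hmax⟩ := wellFounded_gt.has_min
      {T : Submodule (ZMod 2) V | T ≠ ⊥ ∧ T ≠ ⊤ ∧ ¬ Splits X T} ⟨_, hS⟩
    exact ⟨U, hU, fun T hT hUT => by
      by_contra hne
      exact hmax T hT (lt_of_le_of_ne hUT (Ne.symm hne))⟩
  obtain ⟨D, hD⟩ := exists_isMinLink hX hU0 hUt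
  have hmin : ∀ Z ⊂ D, ∑ d ∈ Z, d ∈ U → ∑ d ∈ Z, d = 0 := fun Z hZ hZU => by
    rcases hD.eq_empty_or_eq hZ.1 hZU with rfl | rfl
    · simp
    · exact absurd hZ (ssubset_irrefl _)
  have hnotle : ¬ span (ZMod 2) (D : Set V) ≤ U := fun h => by
    obtain ⟨d, hd⟩ : D.Nonempty := by
      rw [Finset.nonempty_iff_ne_empty]; rintro rfl; exact hD.sum_ne (by simp)
    exact hD.notMem d hd (h (subset_span hd))
  have htop : U ⊔ span (ZMod 2) D = ⊤ := by
    by_contra hne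
    have := hUmax (U ⊔ span (ZMod 2) D)
      ⟨fun h => hU0 (le_bot_iff.1 (h ▸ le_sup_left)), hne,
        not_splits_sup_span hUX hD.subset hD.sum_mem hD.sum_ne hmin⟩ le_sup_left
    exact hnotle (this ▸ le_sup_right)
  have hfin := hD.finrank_lt htop
  have hUlt := Submodule.finrank_lt hUt
  -- A link of at most two elements would make U a hyperplane.
  have h3 : 3 ≤ D.card := by
    by_contra hlt
    exact hUX (hhyp U (by unfold IsHyper; omega))
  have hXD : ∀ g ∈ X, g ∉ U → g ∈ D := fun g hg hgU => hD.mem_of_notMem h3 htop hg hgU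
  obtain ⟨C, hCXU, hCs, hC⟩ : ∃ C : Finset V, (∀ c ∈ C, c ∈ X ∧ c ∈ U) ∧
      ∑ c ∈ C, c = ∑ d ∈ D, d ∧ ∀ C' : Finset V, (∀ c ∈ C', c ∈ X ∧ c ∈ U) →
        ∑ c ∈ C', c = ∑ d ∈ D, d → C.card ≤ C'.card := by
    have hspan : U ≤ span (ZMod 2) (X ∩ U) := by
      by_contra hlt
      refine hUX (Splits.of_le (A := span (ZMod 2) (X ∩ U)) (B := ⊥) disjoint_bot_right
        (fun x hx hxU => Or.inl (subset_span ⟨hx, hxU⟩)) hlt fun h => hU0 (le_bot_iff.1 h))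
    have h : ∃ n, ∃ C : Finset V, ((∀ c ∈ C, c ∈ X ∧ c ∈ U) ∧ ∑ c ∈ C, c = ∑ d ∈ D, d) ∧
        C.card = n := by
      obtain ⟨C, hC, hs⟩ := mem_span_iff_exists_sum.1 (hspan hD.sum_mem)
      exact ⟨_, C, ⟨fun c hc => hC hc, hs⟩, rfl⟩
    obtain ⟨C, ⟨hC1, hC2⟩, hn⟩ := Nat.find_spec h
    exact ⟨C, hC1, hC2, fun C' h1 h2 => hn ▸ Nat.find_min' h ⟨C', ⟨h1, h2⟩, rfl⟩⟩
  obtain ⟨hcir, hcard, hchord⟩ := hD.isSumCircuit_union hXD (fun c hc => (hCXU c hc).2)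
    (fun c hc => (hCXU c hc).1) hCs hC
  have hsubX : ((C ∪ D : Finset V) : Set V) ⊆ X := by
    rw [Finset.coe_union]; exact Set.union_subset (fun c hc => (hCXU c hc).1) hD.subset
  have hC0 : 0 < C.card := by
    rw [Finset.card_pos, Finset.nonempty_iff_ne_empty]
    rintro rfl
    exact hD.sum_ne (by simpa using hCs.symm)
  by_cases hS : span (ZMod 2) ((C ∪ D : Finset V) : Set V) = ⊤
  · refine ⟨C ∪ D, Set.Subset.antisymm hsubX fun x hx => ?_, hcir⟩
    exact hchord x hx (by rintro rfl; exact h0 hx) (hS ▸ mem_top)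
  exfalso
  have hS0 : span (ZMod 2) ((C ∪ D : Finset V) : Set V) ≠ ⊥ := fun h =>
    hnotle ((span_mono (by simp)).trans (h ▸ bot_le))
  have hSY := (hcrit _ hS0 hS).resolve_left (hcir.not_splits hsubX)
  -- As `D` has at least three elements, this leaves one in `C` and three in `D`, so U has dimension
  -- at least four.
  have hle4 : (C ∪ D).card ≤ 4 := by
    by_contra hlt
    refine hcir.not_splits_compl (by omega) (fun x hx hx0 hxn => ?_) hSY
    exact (hXY x hx0).resolve_left fun h => hxn (hchord x h hx0 hx)
  obtain ⟨c, rfl⟩ := Finset.card_eq_one.1 (show C.card = 1 by omega)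
  rw [Finset.sum_singleton] at hCs
  obtain ⟨hcX, hcU⟩ := hCXU c (Finset.mem_singleton_self c)
  have hUY := (hcrit U hU0 hUt).resolve_left hUX
  obtain ⟨J, hJ, hcJ, hUJ, hJX⟩ := exists_isHyper_not_splits hXY (by omega) hUY hcX
  obtain ⟨u, hu, huJ⟩ := SetLike.not_le_iff_exists.1 hUJ
  -- The ear D also closes up in U ⊓ J, since its sum c lies in J. What remains is that the result
  -- is a hyperplane.
  refine not_splits_sup_span hJX hD.subset (hCs ▸ ⟨hcU, hcJ⟩) hD.sum_ne
    (fun Z hZ hZU => hmin Z hZ hZU.1) (hhyp _ ?_)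
  set T := U ⊓ J ⊔ span (ZMod 2) (D : Set V) with hT
  have huT : u ∉ T := by
    intro h
    obtain ⟨k, hk, y, hy, hky⟩ := Submodule.mem_sup.1 h
    obtain ⟨Z, hZ, rfl⟩ := mem_span_iff_exists_sum.1 hy
    have hZU : ∑ d ∈ Z, d ∈ U := mem_of_add_mem_left (hky ▸ hu) hk.1
    refine huJ (hky ▸ J.add_mem hk.2 ?_)
    rcases hD.eq_empty_or_eq (by exact_mod_cast hZ) hZU with rfl | rfl
    · simp
    · exact hCs ▸ hcJ
  have hTtop : T ⊔ span (ZMod 2) {u} = ⊤ := by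
    rw [eq_top_iff, ← htop]
    refine sup_le (fun x hx => ?_) (le_sup_of_le_left le_sup_right)
    by_cases hxJ : x ∈ J
    · exact mem_sup_left (mem_sup_left ⟨hx, hxJ⟩)
    · have h1 : x + u ∈ T := mem_sup_left ⟨U.add_mem hx hu, hJ.add_mem huJ hxJ⟩
      exact mem_of_add_mem_right (mem_sup_left h1) (mem_sup_right (mem_span_singleton_self u))
  have h1 := Submodule.finrank_add_le_finrank_add_finrank T (span (ZMod 2) {u})
  rw [hTtop, finrank_top] at h1
  have h2 := finrank_span_le_card (R := ZMod 2) ({u} : Set V)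
  have h4 := Submodule.finrank_lt (fun h : T = ⊤ => huT (h ▸ mem_top))
  simp only [Set.toFinset_singleton, Finset.card_singleton] at h2
  unfold IsHyper; omega

/-- The configuration of two hyperplanes of different types, where the hyperplane `H` consists,
apart from its intersection with `H'` and at most one further point, of points of `X`. -/
theorem false_of_isHyper_of_isHyper {X Y : Set V} (hr : 6 ≤ finrank (ZMod 2) V)
    (hXY : ∀ x, x ≠ 0 → x ∈ X ∨ x ∈ Y) (hX : ¬ Splits X ⊤) (hY : ¬ Splits Y ⊤)
    (hcrit : ∀ U : Submodule (ZMod 2) V, U ≠ ⊥ → U ≠ ⊤ → Splits X U ∨ Splits Y U)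
    {H H' A B D : Submodule (ZMod 2) V} (hH : IsHyper H) (hH' : IsHyper H')
    (hne : ¬ H ≤ H') (hA : A < H') (hB : B < H') (hAB : Disjoint A B)
    (hXH' : ∀ x ∈ X, x ∈ H' → x ∈ A ∨ x ∈ B) (hD : D ≤ H) (hKD : Disjoint (H ⊓ H') D)
    (hYH : ∀ x ∈ Y, x ∈ H → x ∈ H ⊓ H' ∨ x ∈ D) : False := by
  have hYX : ∀ x, x ≠ 0 → x ∈ Y ∨ x ∈ X := fun x hx => (hXY x hx).symm
  have hK := hH'.finrank_inf hne
  have hHr : finrank (ZMod 2) H + 1 = finrank (ZMod 2) V := hH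
  have hHr' : finrank (ZMod 2) H' + 1 = finrank (ZMod 2) V := hH'
  have hD1 : finrank (ZMod 2) D ≤ 1 := by
    have h1 := Submodule.finrank_sup_add_finrank_inf_eq (H ⊓ H') D
    rw [hKD.eq_bot, finrank_bot] at h1
    have h2 := Submodule.finrank_mono (sup_le (inf_le_left : H ⊓ H' ≤ H) hD)
    omega
  -- With at most one point of Z outside P, the hyperplane P and that point would split Z.
  have two : ∀ {Z : Set V} {P : Submodule (ZMod 2) V}, IsHyper P → ¬ Splits Z ⊤ →
      ∃ x ∈ Z, ∃ y ∈ Z, x ∉ P ∧ y ∉ P ∧ x ≠ y := by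
    intro Z P hP hZ
    have hPr : finrank (ZMod 2) P + 1 = finrank (ZMod 2) V := hP
    obtain ⟨x, hx, hxP⟩ : ∃ x ∈ Z, x ∉ P := by
      by_contra! hcon
      refine hZ (Splits.of_le (A := P) (B := ⊥) disjoint_bot_right
        (fun x hx _ => Or.inl (hcon x hx)) (fun h => ?_) fun h => ?_)
      · rw [top_le_iff.1 h, finrank_top] at hPr; omega
      · have := Submodule.finrank_mono h
        rw [finrank_bot, finrank_top] at this; omega
    by_contra! hcon
    have hx1 := finrank_span_le_card (R := ZMod 2) ({x} : Set V)
    simp only [Set.toFinset_singleton, Finset.card_singleton] at hx1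
    refine hZ (Splits.of_le (A := P) (B := span (ZMod 2) {x}) ?_
      (fun y hy _ => ?_) (fun h => ?_) fun h => ?_)
    · rw [Submodule.disjoint_def]
      intro z hz hzx
      rcases mem_span_singleton_zmodTwo hzx with h | h
      · exact h
      · exact absurd (h ▸ hz) hxP
    · by_cases hyP : y ∈ P
      · exact Or.inl hyP
      · exact Or.inr (hcon x hx y hy hxP hyP ▸ mem_span_singleton_self x)
    · rw [top_le_iff.1 h, finrank_top] at hPr; omega
    · have := Submodule.finrank_mono h
      rw [finrank_top] at this; omega
  obtain ⟨x, hx, y, hy, hxH, hyH, hxy⟩ := two hH hX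
  obtain ⟨p, hp, q, hq, hpH, hqH, hpq⟩ := two hH' hY
  obtain ⟨J, hJ, hJmem, hKJ, hJA, hJB⟩ : ∃ J, IsHyper J ∧ (x ∈ J ∧ y ∈ J ∧ p ∈ J ∧ q ∈ J) ∧
      ¬ H ⊓ H' ≤ J ∧ ¬ H' ⊓ J ≤ A ∧ ¬ H' ⊓ J ≤ B := by
    set Z := span (ZMod 2) ({x, y, p, q} : Set V) with hZ
    have hZ4 : finrank (ZMod 2) Z ≤ 4 := by
      classical
      have h1 := finrank_span_finset_le_card (R := ZMod 2) ({x, y, p, q} : Finset V)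
      have h2 := Finset.card_le_four (a := x) (b := y) (c := p) (d := q)
      have h3 : (({x, y, p, q} : Finset V) : Set V) = {x, y, p, q} := by simp
      rw [h3] at h1
      exact h1.trans h2
    -- Z has dimension at most four and contains p outside H', so no subspace of H' of dimension at
    -- least four fits into it.
    have hZle : ∀ P : Submodule (ZMod 2) V, P ≤ H' → 4 ≤ finrank (ZMod 2) P → ¬ P ≤ Z := by
      intro P hP hP4 hle
      have h1 := Submodule.eq_of_le_of_finrank_le hle (by omega)
      exact hpH (hP (h1 ▸ subset_span (by simp)))
    have hmem : ∀ J : Submodule (ZMod 2) V, Z ≤ J → x ∈ J ∧ y ∈ J ∧ p ∈ J ∧ q ∈ J := fun J h =>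
      ⟨h (subset_span (by simp)), h (subset_span (by simp)), h (subset_span (by simp)),
        h (subset_span (by simp))⟩
    have hKZ := hZle (H ⊓ H') inf_le_right (by omega)
    have hABr : finrank (ZMod 2) A + finrank (ZMod 2) B ≤ finrank (ZMod 2) H' := by
      have h1 := Submodule.finrank_sup_add_finrank_inf_eq A B
      rw [hAB.eq_bot, finrank_bot] at h1
      have h2 := Submodule.finrank_mono (sup_le hA.le hB.le)
      omega
    have key : ∀ A B : Submodule (ZMod 2) V, A < H' →
        finrank (ZMod 2) A + finrank (ZMod 2) B ≤ finrank (ZMod 2) H' →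
        finrank (ZMod 2) B ≤ finrank (ZMod 2) A →
        ∃ J, IsHyper J ∧ Z ≤ J ∧ ¬ H ⊓ H' ≤ J ∧ ¬ H' ⊓ J ≤ A ∧ ¬ H' ⊓ J ≤ B := by
      intro A B hA hABr hle
      obtain ⟨L, hL, hAL⟩ : ∃ L : Submodule (ZMod 2) V, ¬ L ≤ Z ∧
          (A = L ∨ finrank (ZMod 2) A + 1 < finrank (ZMod 2) H') := by
        by_cases h : finrank (ZMod 2) A + 1 < finrank (ZMod 2) H'
        · exact ⟨_, hKZ, Or.inr h⟩
        · exact ⟨A, hZle A hA.le (by omega), Or.inl rfl⟩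
      obtain ⟨J, hJ, hZJ, hKJ, hLJ⟩ := exists_isHyper_not_le_not_le hKZ hL
      have hfr := hJ.finrank_inf (U := H') fun h => hKJ (inf_le_right.trans h)
      refine ⟨J, hJ, hZJ, hKJ, fun h => ?_, fun h => ?_⟩
      · have h1 := Submodule.finrank_mono h
        have h2 := Submodule.finrank_lt_finrank_of_lt hA
        rcases hAL with rfl | h3
        · exact hLJ (Submodule.eq_of_le_of_finrank_eq h (by omega) ▸ inf_le_right)
        · omega
      · have h1 := Submodule.finrank_mono h
        omega
    rcases le_total (finrank (ZMod 2) B) (finrank (ZMod 2) A) with h | h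
    · obtain ⟨J, h1, h2, h3, h4, h5⟩ := key A B hA hABr h
      exact ⟨J, h1, hmem J h2, h3, h4, h5⟩
    · obtain ⟨J, h1, h2, h3, h4, h5⟩ := key B A hB (by omega) h
      exact ⟨J, h1, hmem J h2, h3, h5, h4⟩
  obtain ⟨hxJ, hyJ, hpJ, hqJ⟩ := hJmem
  have hJr : finrank (ZMod 2) J + 1 = finrank (ZMod 2) V := hJ
  have hHJ : ¬ H ≤ J := fun h => hKJ (inf_le_left.trans h)
  have hH'J : ¬ H' ≤ J := fun h => hKJ (inf_le_right.trans h)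
  have hHJr := hJ.finrank_inf hHJ
  have hH'Jr := hJ.finrank_inf hH'J
  have hKJr := hJ.finrank_inf hKJ
  -- P ⊓ J is a hyperplane of J. Not being split by the parts of J, it equals one of them; a and b
  -- then lie in the other, while a + b is in P ⊓ J, so a = b.
  have conclude : ∀ {Z : Set V} {P : Submodule (ZMod 2) V}, IsHyper P →
      finrank (ZMod 2) ↥(P ⊓ J) + 1 = finrank (ZMod 2) J → Splits Z J → ¬ Splits Z (P ⊓ J) →
      ∀ a ∈ Z, ∀ b ∈ Z, a ∈ J → b ∈ J → a ∉ P → b ∉ P → a = b := by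
    rintro Z P hP hPJ ⟨J₁, J₂, h1, h2, h12, hsub⟩ hns a ha b hb haJ hbJ haP hbP
    have key : ∀ J₁ J₂ : Submodule (ZMod 2) V, J₁ < J → Disjoint J₁ J₂ →
        (∀ x ∈ Z, x ∈ J → x ∈ J₁ ∨ x ∈ J₂) → P ⊓ J ≤ J₁ → a = b := by
      intro J₁ J₂ h1 h12 hsub hle
      have h3 := Submodule.finrank_lt_finrank_of_lt h1
      have h4 := Submodule.eq_of_le_of_finrank_le hle (by omega)
      have ha2 := (hsub a ha haJ).resolve_left fun h => haP ((h4 ▸ h : a ∈ P ⊓ J)).1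
      have hb2 := (hsub b hb hbJ).resolve_left fun h => hbP ((h4 ▸ h : b ∈ P ⊓ J)).1
      rw [← add_eq_zero_iff_eq_of_zmodTwo]
      exact eq_zero_of_mem_disjoint h12
        (hle ⟨hP.add_mem hbP haP, J.add_mem haJ hbJ⟩) (add_mem ha2 hb2)
    by_cases hl : P ⊓ J ≤ J₁
    · exact key J₁ J₂ h1 h12 hsub hl
    by_cases hl' : P ⊓ J ≤ J₂
    · exact key J₂ J₁ h2 h12.symm (fun x hx hxJ => (hsub x hx hxJ).symm) hl'
    exact absurd (Splits.of_le (U := P ⊓ J) h12 (fun x hx hxJ => hsub x hx hxJ.2) hl hl') hns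
  have hJ0 : J ≠ ⊥ := by rintro rfl; rw [finrank_bot] at hJr; omega
  have hJt : J ≠ ⊤ := by rintro rfl; exact hKJ le_top
  rcases hcrit J hJ0 hJt with hs | hs
  · refine hxy (conclude hH (by omega) hs ?_ x hx y hy hxJ hyJ hxH hyH)
    refine not_splits_of_splits hXY (by omega) (Splits.of_le hKD
      (fun z hz hzH => hYH z hz hzH.1) (fun h => ?_) fun h => ?_)
    · have := Submodule.finrank_mono (le_inf h inf_le_right)
      omega
    · have := Submodule.finrank_mono h
      omega
  · refine hpq (conclude hH' (by omega) hs ?_ p hp q hq hpJ hqJ hpH hqH)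
    exact not_splits_of_splits hYX (by omega)
      (Splits.of_le hAB (fun z hz hzH => hXH' z hz hzH.1) hJA hJB)

/-- A critical partition of the nonzero vectors of a binary space of dimension at least six
consists of a circuit and its complement. -/
theorem exists_isSumCircuit_of_critical {X Y : Set V} (hr : 6 ≤ finrank (ZMod 2) V)
    (hXY : ∀ x, x ≠ 0 → x ∈ X ∨ x ∈ Y) (hX0 : (0 : V) ∉ X) (hY0 : (0 : V) ∉ Y)
    (hX : ¬ Splits X ⊤) (hY : ¬ Splits Y ⊤)
    (hcrit : ∀ U : Submodule (ZMod 2) V, U ≠ ⊥ → U ≠ ⊤ → Splits X U ∨ Splits Y U) :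
    ∃ C : Finset V, ((C : Set V) = X ∨ (C : Set V) = Y) ∧ IsSumCircuit C := by
  have hYX : ∀ x, x ≠ 0 → x ∈ Y ∨ x ∈ X := fun x hx => (hXY x hx).symm
  have hcrit' : ∀ U : Submodule (ZMod 2) V, U ≠ ⊥ → U ≠ ⊤ → Splits Y U ∨ Splits X U :=
    fun U h1 h2 => (hcrit U h1 h2).symm
  by_cases hhX : ∀ J : Submodule (ZMod 2) V, IsHyper J → Splits X J
  · obtain ⟨C, hC, h⟩ := exists_isSumCircuit_of_isHyper_splits hr hXY hX0 hX hcrit hhX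
    exact ⟨C, Or.inl hC, h⟩
  by_cases hhY : ∀ J : Submodule (ZMod 2) V, IsHyper J → Splits Y J
  · obtain ⟨C, hC, h⟩ := exists_isSumCircuit_of_isHyper_splits hr hYX hY0 hY hcrit' hhY
    exact ⟨C, Or.inr hC, h⟩
  exfalso
  push Not at hhX hhY
  obtain ⟨H, hH, hHX⟩ := hhX
  obtain ⟨H', hH', hHY⟩ := hhY
  have hproper : ∀ J : Submodule (ZMod 2) V, IsHyper J → J ≠ ⊥ ∧ J ≠ ⊤ := by
    intro J hJ
    constructor
    · rintro rfl; rw [IsHyper, finrank_bot] at hJ; omega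
    · rintro rfl; rw [IsHyper, finrank_top] at hJ; omega
  have hsY := (hcrit H (hproper H hH).1 (hproper H hH).2).resolve_left hHX
  have hsX := (hcrit H' (hproper H' hH').1 (hproper H' hH').2).resolve_right hHY
  have hne : ¬ H ≤ H' := fun h => by
    have : H = H' := Submodule.eq_of_le_of_finrank_eq h (by unfold IsHyper at *; omega)
    exact hHX (this ▸ hsX)
  have hne' : ¬ H' ≤ H := fun h => by
    have : H' = H := Submodule.eq_of_le_of_finrank_eq h (by unfold IsHyper at *; omega)
    exact hHX (this ▸ hsX)
  have hK := hH'.finrank_inf hne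
  have hK4 : 4 ≤ finrank (ZMod 2) ↥(H ⊓ H') := by unfold IsHyper at hH; omega
  have eqK : ∀ {P C : Submodule (ZMod 2) V}, IsHyper P → C < P → H ⊓ H' ≤ C → H ⊓ H' = C := by
    intro P C hP hC hle
    have h1 := Submodule.finrank_lt_finrank_of_lt hC
    exact Submodule.eq_of_le_of_finrank_le hle (by unfold IsHyper at *; omega)
  obtain ⟨C, D, hC, hD, hCD, hsubY⟩ := hsY
  obtain ⟨A, B, hA, hB, hAB, hsubX⟩ := hsX
  by_cases hKC : H ⊓ H' ≤ C
  · have h := eqK hH hC hKC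
    exact false_of_isHyper_of_isHyper hr hXY hX hY hcrit hH hH' hne hA hB hAB hsubX hD.le
      (h ▸ hCD) (h ▸ hsubY)
  by_cases hKD : H ⊓ H' ≤ D
  · have h := eqK hH hD hKD
    exact false_of_isHyper_of_isHyper hr hXY hX hY hcrit hH hH' hne hA hB hAB hsubX hC.le
      (h ▸ hCD.symm) (h ▸ fun x hx hxH => (hsubY x hx hxH).symm)
  by_cases hKA : H ⊓ H' ≤ A
  · have h := eqK hH' hA hKA
    rw [inf_comm] at h
    exact false_of_isHyper_of_isHyper hr hYX hY hX hcrit' hH' hH hne' hC hD hCD hsubY hB.le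
      (h ▸ hAB) (h ▸ hsubX)
  by_cases hKB : H ⊓ H' ≤ B
  · have h := eqK hH' hB hKB
    rw [inf_comm] at h
    exact false_of_isHyper_of_isHyper hr hYX hY hX hcrit' hH' hH hne' hC hD hCD hsubY hA.le
      (h ▸ hAB.symm) (h ▸ fun x hx hxH => (hsubX x hx hxH).symm)
  -- No part contains H ⊓ H', so both splittings restrict to it.
  exact not_splits_of_splits hXY hK4
    (Splits.of_le hCD (fun x hx hxK => hsubY x hx hxK.1) hKC hKD)
    (Splits.of_le hAB (fun x hx hxK => hsubX x hx hxK.2) hKA hKB)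

end Critical


/-! ### Hereditary splitting and uniqueness of binary representations. -/

section Hereditary

open Module Submodule

variable {V V' : Type*} [AddCommGroup V] [Module (ZMod 2) V] [AddCommGroup V']
  [Module (ZMod 2) V']

theorem Splits.mono {X Y : Set V} {U : Submodule (ZMod 2) V} (h : Splits Y U)
    (hXY : ∀ x ∈ X, x ∈ U → x ≠ 0 → x ∈ Y) : Splits X U := by
  obtain ⟨A, B, hA, hB, hAB, hsub⟩ := h
  refine ⟨A, B, hA, hB, hAB, fun x hx hxU => ?_⟩
  by_cases h0 : x = 0
  · exact Or.inl (h0 ▸ zero_mem _)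
  · exact hsub x (hXY x hx hxU h0) hxU

/-- In every nonzero subspace the set or its complement splits. -/
def HereditarilySplits (X : Set V) : Prop :=
  ∀ U : Submodule (ZMod 2) V, U ≠ ⊥ → Splits X U ∨ Splits Xᶜ U

theorem hereditarilySplits_empty : HereditarilySplits (∅ : Set V) := fun _ hU =>
  Or.inl ⟨⊥, ⊥, bot_lt_iff_ne_bot.2 hU, bot_lt_iff_ne_bot.2 hU, disjoint_bot_left,
    fun _ hx => absurd hx (Set.notMem_empty _)⟩

theorem HereditarilySplits.compl {X : Set V} (h : HereditarilySplits X) :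
    HereditarilySplits Xᶜ := fun U hU => by
  rw [compl_compl]; exact (h U hU).symm

theorem HereditarilySplits.congr {X Y : Set V} (h : HereditarilySplits X)
    (hXY : ∀ x, x ≠ 0 → (x ∈ X ↔ x ∈ Y)) : HereditarilySplits Y := fun U hU =>
  (h U hU).imp (fun h => h.mono fun x hx _ h0 => (hXY x h0).2 hx)
    fun h => h.mono fun x hx _ h0 hxX => hx ((hXY x h0).1 hxX)

/-- A subspace inside `A` or `B` sees only one summand; any other is split by `A` and `B`. -/
theorem HereditarilySplits.union {X Y : Set V} {A B : Submodule (ZMod 2) V}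
    (hX : HereditarilySplits X) (hY : HereditarilySplits Y) (hXA : X ⊆ A) (hYB : Y ⊆ B)
    (hAB : Disjoint A B) : HereditarilySplits (X ∪ Y) := by
  have key : ∀ {X Y : Set V} {A B : Submodule (ZMod 2) V}, HereditarilySplits X → Y ⊆ B →
      Disjoint A B → ∀ U : Submodule (ZMod 2) V, U ≠ ⊥ → U ≤ A →
        Splits (X ∪ Y) U ∨ Splits (X ∪ Y)ᶜ U := by
    intro X Y A B hX hYB hAB U hU hUA
    refine (hX U hU).imp (fun h => h.mono ?_) fun h => h.mono ?_
    · rintro x (hx | hx) hxU h0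
      · exact hx
      · exact absurd (eq_zero_of_mem_disjoint hAB (hUA hxU) (hYB hx)) h0
    · exact fun x hx _ _ hxX => hx (Or.inl hxX)
  intro U hU
  by_cases hUA : U ≤ A
  · exact key hX hYB hAB U hU hUA
  by_cases hUB : U ≤ B
  · rw [Set.union_comm]
    exact key hY hXA hAB.symm U hU hUB
  exact Or.inl (Splits.of_le hAB (fun x hx _ => hx.imp (hXA ·) (hYB ·)) hUA hUB)

theorem HereditarilySplits.image {X : Set V} {S : Submodule (ZMod 2) V} (f : V →ₗ[ZMod 2] V')
    (hf : InjOn f S) (hXS : X ⊆ S) (hX : HereditarilySplits X) :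
    HereditarilySplits (f '' X) := by
  intro U hU
  by_cases hUS : U ≤ S.map f
  swap
  · refine Or.inl (Splits.of_le (A := S.map f) (B := ⊥) disjoint_bot_right ?_ hUS
      fun h => hU (le_bot_iff.1 h))
    rintro _ ⟨x, hx, rfl⟩ -
    exact Or.inl (mem_map_of_mem (hXS hx))
  have hmem : ∀ y ∈ U, ∃ x ∈ S ⊓ U.comap f, f x = y := fun y hy => by
    obtain ⟨x, hx, rfl⟩ := hUS hy
    exact ⟨x, ⟨hx, hy⟩, rfl⟩
  have transfer : ∀ Z : Set V, ∀ Z' : Set V', (∀ x ∈ S, f x ∈ Z' → x ∈ Z) →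
      Splits Z (S ⊓ U.comap f) → Splits Z' U := by
    rintro Z Z' hZ ⟨A, B, hA, hB, hAB, hsub⟩
    have hlt : ∀ C : Submodule (ZMod 2) V, C < S ⊓ U.comap f → C.map f < U := by
      intro C hC
      refine lt_of_le_of_ne (map_le_iff_le_comap.2 (hC.le.trans inf_le_right)) fun h => ?_
      refine hC.not_ge fun x hx => ?_
      have hfx : f x ∈ C.map f := h ▸ hx.2
      obtain ⟨c, hc, hcx⟩ := hfx
      exact hf (hC.le hc).1 hx.1 hcx ▸ hc
    refine ⟨A.map f, B.map f, hlt A hA, hlt B hB, ?_, ?_⟩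
    · rw [Submodule.disjoint_def]
      rintro _ ⟨a, ha, rfl⟩ ⟨b, hb, hba⟩
      have hab := hf (hB.le hb).1 (hA.le ha).1 hba
      rw [eq_zero_of_mem_disjoint hAB ha (hab ▸ hb), map_zero]
    · intro y hy hyU
      obtain ⟨x, hx, rfl⟩ := hmem y hyU
      exact (hsub x (hZ x hx.1 hy) hx).imp mem_map_of_mem mem_map_of_mem
  have hne : S ⊓ U.comap f ≠ ⊥ := by
    intro h
    refine hU ((Submodule.eq_bot_iff _).2 fun y hy => ?_)
    obtain ⟨x, hx, rfl⟩ := hmem y hy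
    rw [h, Submodule.mem_bot] at hx
    rw [hx, map_zero]
  refine (hX _ hne).imp (transfer _ _ ?_) (transfer _ _ ?_)
  · rintro x hx ⟨z, hz, hzx⟩
    exact hf (hXS hz) hx hzx ▸ hz
  · exact fun x _ hx hxX => hx ⟨x, hxX, rfl⟩

theorem HereditarilySplits.of_image {X : Set V} {S : Submodule (ZMod 2) V} (f : V →ₗ[ZMod 2] V')
    (hf : InjOn f S) (hXS : X ⊆ S) (hX : HereditarilySplits (f '' X)) :
    HereditarilySplits X := by
  intro U hU
  by_cases hUS : U ≤ S
  swap
  · exact Or.inl (Splits.of_le (A := S) (B := ⊥) disjoint_bot_right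
      (fun x hx _ => Or.inl (hXS hx)) hUS fun h => hU (le_bot_iff.1 h))
  have transfer : ∀ Z : Set V, ∀ Z' : Set V', (∀ x ∈ S, x ∈ Z → f x ∈ Z') →
      Splits Z' (U.map f) → Splits Z U := by
    rintro Z Z' hZ ⟨A, B, hA, hB, hAB, hsub⟩
    have hlt : ∀ C : Submodule (ZMod 2) V', C < U.map f → ¬ U ≤ C.comap f := by
      intro C hC h
      exact hC.not_ge (map_le_iff_le_comap.2 h)
    refine ⟨U ⊓ A.comap f, U ⊓ B.comap f, lt_of_le_of_ne inf_le_left fun h =>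
      hlt A hA (h ▸ inf_le_right), lt_of_le_of_ne inf_le_left fun h =>
      hlt B hB (h ▸ inf_le_right), ?_, fun x hx hxU => ?_⟩
    · rw [Submodule.disjoint_def]
      rintro x hxA hxB
      have h0 := eq_zero_of_mem_disjoint hAB hxA.2 hxB.2
      exact hf (hUS hxA.1) S.zero_mem (by rw [h0, map_zero])
    · exact (hsub (f x) (hZ x (hUS hxU) hx) (mem_map_of_mem hxU)).imp (⟨hxU, ·⟩) (⟨hxU, ·⟩)
  have hne : U.map f ≠ ⊥ := by
    intro h
    refine hU ((Submodule.eq_bot_iff _).2 fun y hy => ?_)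
    have h1 : f y ∈ U.map f := mem_map_of_mem hy
    rw [h, Submodule.mem_bot] at h1
    exact hf (hUS hy) S.zero_mem (by rw [h1, map_zero])
  refine (hX _ hne).imp (transfer _ _ fun x _ hx => mem_image_of_mem f hx)
    (transfer _ _ ?_)
  rintro x hx hxX ⟨z, hz, hzx⟩
  exact hxX (hf (hXS hz) hx hzx ▸ hz)

/-- A relation on D for x makes D dependent for y, so some nonempty J ⊆ D is a relation for y. If J
is proper, J and D \ J are relations for x, hence for y, by the hypothesis on proper subsets. -/
theorem sum_eq_zero_of_linearIndepOn_imp {ι : Type*} {D : Finset ι} {x : ι → V} {y : ι → V'}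
    (hxy : LinearIndepOn (ZMod 2) y D → LinearIndepOn (ZMod 2) x D)
    (ih : ∀ Z ⊂ D, ∑ d ∈ Z, x d = 0 ↔ ∑ d ∈ Z, y d = 0) (h0 : ∑ d ∈ D, x d = 0) :
    ∑ d ∈ D, y d = 0 := by
  classical
  by_cases hDe : D = ∅
  · simp [hDe]
  have hdep : ¬ LinearIndepOn (ZMod 2) y D := fun hi =>
    hDe (linearIndepOn_zmodTwo_iff.1 (hxy hi) D subset_rfl h0)
  rw [linearIndepOn_zmodTwo_iff] at hdep
  push Not at hdep
  obtain ⟨J, hJ, hJ0, hJe⟩ := hdep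
  have hJ' : J ⊆ D := by exact_mod_cast hJ
  by_cases hJD : J = D
  · rwa [hJD] at hJ0
  have h1 := (ih J (lt_of_le_of_ne hJ' hJD)).2 hJ0
  have hss : D \ J ⊂ D := by
    refine lt_of_le_of_ne Finset.sdiff_subset fun he => hJe.ne_empty ?_
    rw [Finset.sdiff_eq_self_iff_disjoint, disjoint_comm,
      Finset.disjoint_iff_inter_eq_empty, Finset.inter_eq_left.2 hJ'] at he
    exact he
  have h2 : ∑ d ∈ D \ J, x d = 0 := by
    rw [← Finset.sum_sdiff hJ', h1, add_zero] at h0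
    exact h0
  rw [← Finset.sum_sdiff hJ', hJ0, add_zero]
  exact (ih _ hss).1 h2

/-- Binary representations are determined by independence: two families of vectors over `GF(2)`
with the same independent sets have the same linear relations. -/
theorem sum_eq_zero_of_linearIndepOn_iff {ι : Type*} {E : Set ι} {v : ι → V} {w : ι → V'}
    (h : ∀ I ⊆ E, LinearIndepOn (ZMod 2) v I ↔ LinearIndepOn (ZMod 2) w I) (D : Finset ι)
    (hD : (D : Set ι) ⊆ E) : ∑ d ∈ D, v d = 0 ↔ ∑ d ∈ D, w d = 0 := by
  induction D using Finset.strongInduction with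
  | H D ih =>
  have ih' : ∀ Z ⊂ D, ∑ d ∈ Z, v d = 0 ↔ ∑ d ∈ Z, w d = 0 := fun Z hZ =>
    ih Z hZ ((Finset.coe_subset.2 hZ.1).trans hD)
  exact ⟨sum_eq_zero_of_linearIndepOn_imp (h D hD).2 ih',
    sum_eq_zero_of_linearIndepOn_imp (h D hD).1 fun Z hZ => (ih' Z hZ).symm⟩

theorem HereditarilySplits.image_of_linearIndepOn_iff {ι : Type*} {E : Set ι} {v : ι → V}
    {w : ι → V'}
    (h : ∀ I ⊆ E, LinearIndepOn (ZMod 2) v I ↔ LinearIndepOn (ZMod 2) w I)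
    (hv : HereditarilySplits (v '' E)) : HereditarilySplits (w '' E) := by
  -- On the span of the joint vectors (v i, w i) both projections are injective, because v and w
  -- have the same relations.
  set g : ι → V × V' := fun i => (v i, w i) with hg
  have hS : g '' E ⊆ span (ZMod 2) (g '' E) := subset_span
  have hrel : ∀ x ∈ span (ZMod 2) (g '' E), x.1 = 0 ↔ x.2 = 0 := by
    intro x hx
    classical
    obtain ⟨D, hD, rfl⟩ := mem_span_iff_exists_sum.1 hx
    obtain ⟨D', hD', hinj, rfl⟩ : ∃ D' : Finset ι, (D' : Set ι) ⊆ E ∧ InjOn g D' ∧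
        D'.image g = D := by
      obtain ⟨t, ht, hb⟩ := (surjOn_image g E).mono subset_rfl hD |>.exists_bijOn_subset
      have hfin : t.Finite := hb.finite_iff_finite.2 D.finite_toSet
      refine ⟨hfin.toFinset, by simpa using ht, by simpa using hb.injOn, ?_⟩
      rw [← Finset.coe_inj, Finset.coe_image, hfin.coe_toFinset, hb.image_eq]
    rw [Finset.sum_image hinj, Prod.fst_sum, Prod.snd_sum]
    exact sum_eq_zero_of_linearIndepOn_iff h D' hD'
  have h1 : InjOn (LinearMap.fst (ZMod 2) V V') (span (ZMod 2) (g '' E)) := by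
    intro x hx y hy hxy
    rw [← add_eq_zero_iff_eq_of_zmodTwo]
    have h0 : (x + y).1 = 0 := add_eq_zero_iff_eq_of_zmodTwo.2 hxy
    exact Prod.ext h0 ((hrel _ (add_mem hx hy)).1 h0)
  have h2 : InjOn (LinearMap.snd (ZMod 2) V V') (span (ZMod 2) (g '' E)) := by
    intro x hx y hy hxy
    rw [← add_eq_zero_iff_eq_of_zmodTwo]
    have h0 : (x + y).2 = 0 := add_eq_zero_iff_eq_of_zmodTwo.2 hxy
    exact Prod.ext ((hrel _ (add_mem hx hy)).2 h0) h0
  have h3 : HereditarilySplits (g '' E) := by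
    refine HereditarilySplits.of_image _ h1 hS ?_
    rwa [Set.image_image]
  have h4 := h3.image _ h2 hS
  rwa [Set.image_image] at h4

end Hereditary


/-! ### Representations of matroids over GF(2). -/

namespace Matroid

open Module Submodule

section Rep

variable {α β : Type*} {V V' : Type*} [AddCommGroup V] [Module (ZMod 2) V] [AddCommGroup V']
  [Module (ZMod 2) V']

/-- The vectors `v` represent the matroid `M` over `GF(2)`. -/
def IsRep (M : Matroid α) (v : α → V) : Prop :=
  ∀ I ⊆ M.E, M.Indep I ↔ LinearIndepOn (ZMod 2) v I

theorem _root_.linearIndepOn_comp_iff {ι κ : Type*} {f : ι → κ} {g : κ → V} {s : Set ι}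
    (hf : InjOn f s) : LinearIndepOn (ZMod 2) (g ∘ f) s ↔ LinearIndepOn (ZMod 2) g (f '' s) :=
  linearIndependent_equiv' (Equiv.Set.imageOfInjOn f s hf) rfl

theorem IsIsomorphic.symm {M : Matroid α} {N : Matroid β} (h : M.IsIsomorphic N) :
    N.IsIsomorphic M := by
  obtain ⟨e, he⟩ := h
  refine ⟨e.symm, fun I => ?_⟩
  have h1 : e '' (e.symm '' I) = I := by rw [← Set.image_comp]; simp
  rw [he, h1]

theorem IsIsomorphic.exists_isRep {M : Matroid α} {N : Matroid β} (h : M.IsIsomorphic N)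
    {w : β → V} (hw : N.IsRep w) :
    ∃ v : α → V, M.IsRep v ∧ v '' M.E = w '' N.E ∧ (InjOn w N.E → InjOn v M.E) := by
  classical
  obtain ⟨e, he⟩ := h
  set v : α → V := fun x => if hx : x ∈ M.E then w (e ⟨x, hx⟩) else 0 with hv
  have hve : ∀ x : M.E, v x = w (e x) := fun x => by simp [hv, x.2]
  have hve' : v ∘ (Subtype.val : M.E → α) = w ∘ (Subtype.val : N.E → β) ∘ e := funext hve
  refine ⟨v, fun I hI => ?_, ?_, fun hinj x hx y hy hxy => ?_⟩
  · obtain ⟨I, rfl⟩ : ∃ J : Set M.E, Subtype.val '' J = I :=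
      ⟨Subtype.val ⁻¹' I, by simpa using hI⟩
    rw [he, hw _ (by rintro _ ⟨x, -, rfl⟩; exact x.2), ← Set.image_comp,
      ← linearIndepOn_comp_iff (Subtype.val_injective.injOn),
      ← linearIndepOn_comp_iff (Subtype.val_injective.comp e.injective).injOn, hve']
  · ext y
    constructor
    · rintro ⟨x, hx, rfl⟩
      exact ⟨e ⟨x, hx⟩, (e ⟨x, hx⟩).2, (hve ⟨x, hx⟩).symm⟩
    · rintro ⟨x, hx, rfl⟩
      refine ⟨e.symm ⟨x, hx⟩, (e.symm ⟨x, hx⟩).2, ?_⟩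
      rw [hve]; simp
  · have h1 := hve ⟨x, hx⟩
    have h2 := hve ⟨y, hy⟩
    simp only at h1 h2
    have h3 := hinj (e ⟨x, hx⟩).2 (e ⟨y, hy⟩).2 (by rw [← h1, ← h2, hxy])
    simpa using e.injective (Subtype.val_injective h3)

theorem IsRep.isIsomorphic {M : Matroid α} {N : Matroid β} {v : α → V} {w : β → V}
    (hv : M.IsRep v) (hw : N.IsRep w) (hvi : InjOn v M.E) (hwi : InjOn w N.E)
    (h : v '' M.E = w '' N.E) : M.IsIsomorphic N := by
  set e : M.E ≃ N.E := (Equiv.Set.imageOfInjOn v M.E hvi).trans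
    ((Equiv.setCongr h).trans (Equiv.Set.imageOfInjOn w N.E hwi).symm) with he
  have hew : ∀ x : M.E, w (e x) = v x := fun x => by
    have h1 : ∀ z : w '' N.E, w ((Equiv.Set.imageOfInjOn w N.E hwi).symm z) = z := fun z => by
      have := (Equiv.Set.imageOfInjOn w N.E hwi).apply_symm_apply z
      exact congrArg Subtype.val this
    simp only [he, Equiv.trans_apply]
    rw [h1]; rfl
  have hve' : v ∘ (Subtype.val : M.E → α) = w ∘ (Subtype.val : N.E → β) ∘ e :=
    funext fun x => (hew x).symm
  refine ⟨e, fun I => ?_⟩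
  rw [hv _ (by rintro _ ⟨x, -, rfl⟩; exact x.2), hw _ (by rintro _ ⟨x, -, rfl⟩; exact x.2),
    ← Set.image_comp, ← linearIndepOn_comp_iff (Subtype.val_injective.injOn),
    ← linearIndepOn_comp_iff (Subtype.val_injective.comp e.injective).injOn, hve']

theorem IsRep.comp {M : Matroid α} {v : α → V} (hv : M.IsRep v) (f : V →ₗ[ZMod 2] V')
    (hf : InjOn f (span (ZMod 2) (v '' M.E))) : M.IsRep (f ∘ v) := fun I hI => by
  rw [hv I hI, f.linearIndepOn_iff_of_injOn (hf.mono (span_mono (image_mono hI)))]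

theorem IsRep.restrict {M : Matroid α} {v : α → V} (hv : M.IsRep v) {F : Set α}
    (hF : F ⊆ M.E) : (M.restrict F).IsRep v := fun I hI => by
  rw [restrict_indep_iff, hv I (hI.trans hF)]
  exact and_iff_left hI

theorem IsRep.delete {M : Matroid α} {v : α → V} (hv : M.IsRep v) (T : Set α) :
    (M.delete T).IsRep v := fun I hI => by
  rw [delete_indep_iff, hv I (hI.trans sdiff_subset)]
  exact and_iff_left (disjoint_left.2 fun x hx => (hI hx).2)

theorem binaryPG_isRep (k : ℕ) : (binaryPG k).IsRep (id : (Fin k → ZMod 2) → _) :=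
  fun _ _ => Iff.rfl

theorem IsRep.injOn {M : Matroid α} {v : α → V} (hv : M.IsRep v) (hM : M.IsSimple) :
    InjOn v M.E := fun e he f hf h =>
  ((hv {e, f} (pair_subset he hf)).1 (hM e he f hf)).injOn (by simp) (by simp) h

theorem IsRep.ne_zero {M : Matroid α} {v : α → V} (hv : M.IsRep v) (hM : M.IsSimple)
    {e : α} (he : e ∈ M.E) : v e ≠ 0 :=
  ((hv {e, e} (pair_subset he he)).1 (hM e he e he)).ne_zero (by simp)

theorem IsRep.isFlat {M : Matroid α} {v : α → V} (hv : M.IsRep v) (U : Submodule (ZMod 2) V) :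
    M.IsFlat {e ∈ M.E | v e ∈ U} := by
  refine ⟨fun I X hI hX x hx => ⟨hX.subset_ground hx, ?_⟩, fun e he => he.1⟩
  by_cases hxI : x ∈ I
  · exact (hI.subset hxI).2
  have h1 := (hX.insert_dep ⟨hx, hxI⟩).not_indep
  have hIE := hX.indep.subset_ground
  rw [hv _ (insert_subset (hX.subset_ground hx) hIE), linearIndepOn_insert hxI] at h1
  have h2 : v x ∈ span (ZMod 2) (v '' I) := by
    by_contra h
    exact h1 ⟨(hv I hIE).1 hX.indep, h⟩
  refine (span_le.2 ?_ : span (ZMod 2) (v '' I) ≤ U) h2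
  rintro _ ⟨i, hi, rfl⟩
  exact (hI.subset hi).2

theorem IsRep.span_le_of_isBase {M : Matroid α} {v : α → V} (hv : M.IsRep v) {B : Set α}
    (hB : M.IsBase B) : span (ZMod 2) (v '' M.E) ≤ span (ZMod 2) (v '' B) := by
  refine span_le.2 ?_
  rintro _ ⟨x, hx, rfl⟩
  by_cases hxB : x ∈ B
  · exact subset_span (mem_image_of_mem v hxB)
  have h1 := (hB.insert_dep ⟨hx, hxB⟩).not_indep
  rw [hv _ (insert_subset hx hB.subset_ground), linearIndepOn_insert hxB] at h1
  by_contra h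
  exact h1 ⟨(hv B hB.subset_ground).1 hB.indep, h⟩

theorem IsRep.finrank_span {M : Matroid α} {v : α → V} (hv : M.IsRep v) {r : ℕ}
    (hr : M.eRank = r) : finrank (ZMod 2) (span (ZMod 2) (v '' M.E)) = r := by
  obtain ⟨B, hB⟩ := M.exists_isBase
  have hcard := hB.encard_eq_eRank
  rw [hr] at hcard
  have hfin : B.Finite := Set.finite_of_encard_eq_coe hcard
  have hind := (hv B hB.subset_ground).1 hB.indep
  have hspan : span (ZMod 2) (v '' M.E) = span (ZMod 2) (v '' B) :=
    le_antisymm (hv.span_le_of_isBase hB) (span_mono (image_mono hB.subset_ground))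
  have := hfin.fintype
  have h1 := finrank_span_eq_card (R := ZMod 2) (b := fun x : B => v x) hind
  rw [hspan, Set.image_eq_range, h1, ← Set.toFinset_card, ← Set.ncard_eq_toFinset_card',
    Set.ncard, hcard, ENat.toNat_natCast]

theorem IsRep.eRank_le {M : Matroid α} {k : ℕ} {v : α → Fin k → ZMod 2} (hv : M.IsRep v) :
    M.eRank ≤ k := by
  obtain ⟨B, hB⟩ := M.exists_isBase
  rw [← hB.encard_eq_eRank]
  have hind := (hv B hB.subset_ground).1 hB.indep
  have hfin : Finite B := hind.linearIndependent.finite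
  have := Fintype.ofFinite B
  have h1 := hind.linearIndependent.fintype_card_le_finrank
  rw [finrank_fin_fun] at h1
  rw [Set.encard_eq_coe_toFinset_card, Set.toFinset_card]
  exact_mod_cast h1

theorem _root_.linearIndepOn_sumElim_iff {v : α → V} {w : β → V} {A B : Submodule (ZMod 2) V}
    (hAB : Disjoint A B) {I : Set (α ⊕ β)} (hv : ∀ x, .inl x ∈ I → v x ∈ A)
    (hw : ∀ x, .inr x ∈ I → w x ∈ B) :
    LinearIndepOn (ZMod 2) (Sum.elim v w) I ↔
      LinearIndepOn (ZMod 2) v (Sum.inl ⁻¹' I) ∧ LinearIndepOn (ZMod 2) w (Sum.inr ⁻¹' I) := by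
  have hsum : ∀ D : Finset (α ⊕ β), ∑ d ∈ D, Sum.elim v w d =
      ∑ d ∈ D.toLeft, v d + ∑ d ∈ D.toRight, w d := fun D => by
    conv_lhs => rw [← Finset.toLeft_disjSum_toRight (u := D), Finset.sum_disjSum]
    simp
  refine ⟨fun h => ⟨?_, ?_⟩, fun ⟨h1, h2⟩ => ?_⟩
  · exact (linearIndepOn_comp_iff (g := Sum.elim v w) Sum.inl_injective.injOn).2
      (h.mono (image_preimage_subset _ _))
  · exact (linearIndepOn_comp_iff (g := Sum.elim v w) Sum.inr_injective.injOn).2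
      (h.mono (image_preimage_subset _ _))
  · rw [linearIndepOn_zmodTwo_iff] at h1 h2 ⊢
    intro D hD h0
    rw [hsum, add_eq_zero_iff_eq_of_zmodTwo] at h0
    have hl : ∀ d ∈ D.toLeft, .inl d ∈ I := fun d hd => hD (Finset.mem_toLeft.1 hd)
    have hr : ∀ d ∈ D.toRight, .inr d ∈ I := fun d hd => hD (Finset.mem_toRight.1 hd)
    have hA : ∑ d ∈ D.toLeft, v d ∈ A := sum_mem fun d hd => hv d (hl d hd)
    have hB : ∑ d ∈ D.toRight, w d ∈ B := sum_mem fun d hd => hw d (hr d hd)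
    have h3 := eq_zero_of_mem_disjoint hAB hA (h0 ▸ hB)
    have h4 := h1 _ hl h3
    have h5 := h2 _ hr (h0 ▸ h3)
    rw [← Finset.toLeft_disjSum_toRight (u := D), h4, h5]
    rfl

theorem IsRep.sum {M : Matroid α} {N : Matroid β} {v : α → V} {w : β → V} (hv : M.IsRep v)
    (hw : N.IsRep w) {A B : Submodule (ZMod 2) V} (hAB : Disjoint A B) (hA : v '' M.E ⊆ A)
    (hB : w '' N.E ⊆ B) : (M.sum N).IsRep (Sum.elim v w) := by
  intro I hI
  have h1 : Sum.inl ⁻¹' I ⊆ M.E := fun x hx => by simpa using hI hx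
  have h2 : Sum.inr ⁻¹' I ⊆ N.E := fun x hx => by simpa using hI hx
  rw [sum_indep_iff, hv _ h1, hw _ h2]
  exact (linearIndepOn_sumElim_iff hAB (fun x hx => hA (mem_image_of_mem v (h1 hx)))
    fun x hx => hB (mem_image_of_mem w (h2 hx))).symm

theorem IsRep.of_sum_left {M : Matroid α} {N : Matroid β} {v : α ⊕ β → V}
    (hv : (M.sum N).IsRep v) : M.IsRep (v ∘ .inl) := fun I hI => by
  rw [linearIndepOn_comp_iff Sum.inl_injective.injOn, ← hv, sum_indep_iff,
    preimage_image_eq _ Sum.inl_injective]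
  · simp
  · rw [sum_ground]; exact (image_mono hI).trans subset_union_left

theorem IsRep.of_sum_right {M : Matroid α} {N : Matroid β} {v : α ⊕ β → V}
    (hv : (M.sum N).IsRep v) : N.IsRep (v ∘ .inr) := fun I hI => by
  rw [linearIndepOn_comp_iff Sum.inr_injective.injOn, ← hv, sum_indep_iff,
    preimage_image_eq _ Sum.inr_injective]
  · simp
  · rw [sum_ground]; exact (image_mono hI).trans subset_union_right

theorem IsRep.disjoint_span_of_sum {M : Matroid α} {N : Matroid β} {v : α ⊕ β → V}
    (hv : (M.sum N).IsRep v) :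
    Disjoint (span (ZMod 2) ((v ∘ .inl) '' M.E)) (span (ZMod 2) ((v ∘ .inr) '' N.E)) := by
  obtain ⟨B, hB⟩ := M.exists_isBase
  obtain ⟨C, hC⟩ := N.exists_isBase
  refine Disjoint.mono (hv.of_sum_left.span_le_of_isBase hB)
    (hv.of_sum_right.span_le_of_isBase hC) ?_
  have hind : LinearIndepOn (ZMod 2) v (Sum.inl '' B ∪ Sum.inr '' C) := by
    rw [← hv, sum_indep_iff]
    · rw [preimage_union, preimage_union, preimage_image_eq _ Sum.inl_injective,
        preimage_image_eq _ Sum.inr_injective]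
      simpa using ⟨hB.indep, hC.indep⟩
    · rw [sum_ground]
      exact union_subset_union (image_mono hB.subset_ground) (image_mono hC.subset_ground)
  have hd : Disjoint (Sum.inl '' B : Set (α ⊕ β)) (Sum.inr '' C) := by
    rw [Set.disjoint_left]
    rintro _ ⟨x, -, rfl⟩ ⟨y, -, h⟩
    cases h
  have := (linearIndepOn_union_iff hd).1 hind
  rw [Set.image_comp, Set.image_comp]
  exact this.2.2

theorem IsRep.isCircuit {M : Matroid α} {v : α → V} (hv : M.IsRep v) (hinj : InjOn v M.E)
    {C : Finset V} (hC : IsSumCircuit C) (hCM : (C : Set V) = v '' M.E) : M.IsCircuit M.E := by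
  classical
  have hdep : ∀ D ⊆ M.E, M.Indep D ↔ LinearIndepOn (ZMod 2) id (v '' D) := fun D hD => by
    rw [hv D hD, linearIndepOn_iff_image (hinj.mono hD)]
  rw [isCircuit_iff]
  refine ⟨⟨fun h => ?_, subset_rfl⟩, fun D hD hDE => ?_⟩
  · rw [hdep _ subset_rfl, ← hCM, linearIndepOn_zmodTwo_iff] at h
    have := h C subset_rfl (by simpa using hC.sum_eq_zero)
    exact hC.nonempty.ne_empty this
  · have h := hD.not_indep
    rw [hdep D hDE, linearIndepOn_zmodTwo_iff] at h
    push Not at h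
    obtain ⟨Z, hZ, hZ0, hZe⟩ := h
    have hZC : Z ⊆ C := Finset.coe_subset.1 (hCM ▸ hZ.trans (image_mono hDE))
    have hZC' : Z = C := (hC.minimal Z hZC (by simpa using hZ0)).resolve_left hZe.ne_empty
    refine Subset.antisymm hDE fun x hx => ?_
    have h1 : v x ∈ (C : Set V) := hCM ▸ mem_image_of_mem v hx
    rw [← hZC'] at h1
    obtain ⟨y, hy, hyx⟩ := hZ h1
    exact hinj (hDE hy) hx hyx ▸ hy

end Rep

end Matroid


/-! ### Comatroids and splitting. -/

namespace Matroid

open Module Submodule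

theorem IsRep.hereditarilySplits {α : Type*} {V V' : Type*} [AddCommGroup V]
    [Module (ZMod 2) V] [AddCommGroup V'] [Module (ZMod 2) V'] {M : Matroid α} {v : α → V}
    {w : α → V'} (hv : M.IsRep v) (hw : M.IsRep w) (h : HereditarilySplits (v '' M.E)) :
    HereditarilySplits (w '' M.E) :=
  h.image_of_linearIndepOn_iff fun I hI => (hv I hI).symm.trans (hw I hI)

theorem IsBinaryComatroid.hereditarilySplits {α : Type u} {M : Matroid α}
    (hM : M.IsBinaryComatroid) : ∀ {k : ℕ} (v : α → Fin k → ZMod 2), M.IsRep v →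
      HereditarilySplits (v '' M.E) := by
  induction hM with
  | empty α =>
    intro k v _
    rw [emptyOn_ground, image_empty]
    exact hereditarilySplits_empty
  | @directSum α β M N _ _ ihM ihN =>
    intro k v hv
    have h1 := ihM _ hv.of_sum_left
    have h2 := ihN _ hv.of_sum_right
    have h3 := h1.union h2 subset_span subset_span hv.disjoint_span_of_sum
    rwa [image_comp, image_comp, ← image_union, ← sum_ground] at h3
  | @complement α β M N t _ _ hMN ih =>
    intro k w hw
    obtain ⟨T, hT, hMT, hNT⟩ := hMN
    obtain ⟨v, hv, hvT, -⟩ := hMT.exists_isRep ((binaryPG_isRep t).restrict hT)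
    obtain ⟨v', hv', hvT', -⟩ := hNT.exists_isRep ((binaryPG_isRep t).delete T)
    have h1 := ih v hv
    rw [hvT, image_id, restrict_ground_eq] at h1
    -- The set complement also contains the zero vector, which never affects splitting.
    refine hv'.hereditarilySplits hw (h1.compl.congr fun x hx => ?_)
    rw [hvT', image_id, delete_ground, binaryPG_ground]
    exact ⟨fun h => ⟨hx, h⟩, fun h => h.2⟩
  | @iso α β M N _ hMN ih =>
    intro k w hw
    obtain ⟨v, hv, hvw, -⟩ := hMN.exists_isRep hw
    rw [← hvw]
    exact ih v hv

/-- The restriction of `PG(k-1, 2)` to a set of vectors, on a copy of the ground set in a given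
universe. -/
noncomputable def liftPG (k : ℕ) (S : Set (Fin k → ZMod 2)) :
    Matroid (ULift.{u} (Fin k → ZMod 2)) :=
  ((binaryPG k).restrict S).mapEquiv Equiv.ulift.symm

theorem image_down_liftPG (k : ℕ) (S : Set (Fin k → ZMod 2)) :
    ULift.down '' (liftPG.{u} k S).E = S := by
  ext x
  simp [liftPG]

theorem liftPG_isRep (k : ℕ) {S : Set (Fin k → ZMod 2)} (hS : S ⊆ {x | x ≠ 0}) :
    (liftPG.{u} k S).IsRep ULift.down := by
  intro I hI
  have h1 : (Equiv.ulift.symm.symm '' I : Set (Fin k → ZMod 2)) ⊆ S := by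
    rw [← image_down_liftPG.{u} k S]; exact image_mono hI
  rw [liftPG, mapEquiv_indep_iff, (binaryPG_isRep k).restrict hS _ h1,
    ← linearIndepOn_comp_iff (Equiv.injective _).injOn]
  rfl

theorem down_injOn {k : ℕ} (S : Set (ULift.{u} (Fin k → ZMod 2))) : InjOn ULift.down S :=
  ULift.down_injective.injOn

theorem IsRep.isBinaryComatroid_iff {α : Type u} {M : Matroid α} {k : ℕ}
    {v : α → Fin k → ZMod 2} (hv : M.IsRep v) (hinj : InjOn v M.E) (h0 : ∀ e ∈ M.E, v e ≠ 0) :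
    M.IsBinaryComatroid ↔ (liftPG.{u} k (v '' M.E)).IsBinaryComatroid := by
  have h1 : v '' M.E ⊆ {x | x ≠ 0} := by rintro _ ⟨e, he, rfl⟩; exact h0 e he
  have hiso := hv.isIsomorphic (liftPG_isRep.{u} k h1) hinj (down_injOn _)
    (image_down_liftPG.{u} k _).symm
  exact ⟨fun h => h.iso hiso, fun h => h.iso hiso.symm⟩

theorem isBinaryComatroid_liftPG_union {k : ℕ} {S T : Set (Fin k → ZMod 2)}
    {A B : Submodule (ZMod 2) (Fin k → ZMod 2)} (hAB : Disjoint A B) (hSA : S ⊆ A) (hTB : T ⊆ B)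
    (hS0 : S ⊆ {x | x ≠ 0}) (hT0 : T ⊆ {x | x ≠ 0})
    (hS : (liftPG.{u} k S).IsBinaryComatroid) (hT : (liftPG.{u} k T).IsBinaryComatroid) :
    (liftPG.{u} k (S ∪ T)).IsBinaryComatroid := by
  have hrep := (liftPG_isRep.{u} k hS0).sum (liftPG_isRep.{u} k hT0) hAB
    ((image_down_liftPG k S).trans_subset hSA) ((image_down_liftPG k T).trans_subset hTB)
  have hmemS : ∀ x ∈ (liftPG.{u} k S).E, x.down ∈ S := fun x hx => by
    rw [← image_down_liftPG.{u} k S]; exact mem_image_of_mem _ hx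
  have hmemT : ∀ x ∈ (liftPG.{u} k T).E, x.down ∈ T := fun x hx => by
    rw [← image_down_liftPG.{u} k T]; exact mem_image_of_mem _ hx
  have himg : Sum.elim ULift.down ULift.down '' ((liftPG.{u} k S).sum (liftPG.{u} k T)).E
      = S ∪ T := by
    rw [sum_ground, image_union, ← image_comp, ← image_comp]
    exact congrArg₂ _ (image_down_liftPG k S) (image_down_liftPG k T)
  refine (hS.directSum hT).iso (hrep.isIsomorphic
    (liftPG_isRep.{u} k (union_subset hS0 hT0)) ?_ (down_injOn _) ?_)
  · rw [sum_ground]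
    rintro (x | x) hx (y | y) hy h
    · exact congrArg _ (ULift.down_injective h)
    · have hx' : x ∈ (liftPG.{u} k S).E := by simpa using hx
      have hy' : y ∈ (liftPG.{u} k T).E := by simpa using hy
      have h' : x.down = y.down := h
      exact absurd (eq_zero_of_mem_disjoint hAB (hSA (hmemS x hx'))
        (h' ▸ hTB (hmemT y hy'))) (hS0 (hmemS x hx'))
    · have hx' : x ∈ (liftPG.{u} k T).E := by simpa using hx
      have hy' : y ∈ (liftPG.{u} k S).E := by simpa using hy
      have h' : x.down = y.down := h
      exact absurd (eq_zero_of_mem_disjoint hAB (hSA (hmemS y hy'))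
        (h' ▸ hTB (hmemT x hx'))) (hS0 (hmemS y hy'))
    · exact congrArg _ (ULift.down_injective h)
  · rw [himg, image_down_liftPG]

/-- Complements may be taken inside any subspace `A` containing `S`: an isomorphism of `A` with
GF(2)^t turns its nonzero vectors into PG(t-1, 2). -/
theorem isBinaryComatroid_liftPG_compl {k : ℕ} {S : Set (Fin k → ZMod 2)}
    {A : Submodule (ZMod 2) (Fin k → ZMod 2)} (hSA : S ⊆ A) (hS0 : S ⊆ {x | x ≠ 0})
    (hS : (liftPG.{u} k S).IsBinaryComatroid) :
    (liftPG.{u} k {x | x ≠ 0 ∧ x ∈ A ∧ x ∉ S}).IsBinaryComatroid := by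
  set t := finrank (ZMod 2) A with ht
  obtain ⟨e⟩ : Nonempty (A ≃ₗ[ZMod 2] (Fin t → ZMod 2)) :=
    ⟨LinearEquiv.ofFinrankEq _ _ (by rw [finrank_fin_fun])⟩
  obtain ⟨f, hf⟩ := (e : A →ₗ[ZMod 2] (Fin t → ZMod 2)).exists_extend
  have hfe : ∀ x (hx : x ∈ A), f x = e ⟨x, hx⟩ := fun x hx => LinearMap.congr_fun hf ⟨x, hx⟩
  have hfinj : InjOn f A := fun x hx y hy hxy => by
    rw [hfe x hx, hfe y hy] at hxy
    simpa using e.injective hxy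
  have hfsurj : ∀ y, ∃ x ∈ A, f x = y := fun y =>
    ⟨e.symm y, (e.symm y).2, by rw [hfe _ (e.symm y).2]; simp⟩
  have hf0 : ∀ x ∈ A, x ≠ 0 → f x ≠ 0 := fun x hx hx0 h =>
    hx0 (hfinj hx A.zero_mem (h.trans (map_zero f).symm))
  have hT : f '' S ⊆ (binaryPG t).E := by
    rintro _ ⟨x, hx, rfl⟩; exact hf0 x (hSA hx) (hS0 hx)
  have hrep : ∀ R : Set (Fin k → ZMod 2), R ⊆ A → R ⊆ {x | x ≠ 0} →
      (liftPG.{u} k R).IsRep (f ∘ ULift.down) ∧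
      InjOn (f ∘ ULift.down) (liftPG.{u} k R).E ∧
      (f ∘ ULift.down) '' (liftPG.{u} k R).E = f '' R := by
    intro R hRA hR0
    refine ⟨(liftPG_isRep k hR0).comp f ?_, ?_, ?_⟩
    · rw [image_down_liftPG]
      exact hfinj.mono (span_le.2 hRA)
    · refine InjOn.comp (t := R) (hfinj.mono hRA) (down_injOn _) fun x hx => ?_
      rw [← image_down_liftPG.{u} k R]; exact mem_image_of_mem _ hx
    · rw [image_comp, image_down_liftPG]
  obtain ⟨h1, h2, h3⟩ := hrep S hSA hS0
  obtain ⟨h4, h5, h6⟩ := hrep {x | x ≠ 0 ∧ x ∈ A ∧ x ∉ S} (fun x hx => hx.2.1) fun x hx => hx.1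
  refine hS.complement t h1.eRank_le ⟨f '' S, hT, ?_, ?_⟩
  · exact h1.isIsomorphic ((binaryPG_isRep t).restrict hT) h2 (injOn_id _)
      (by rw [h3, image_id, restrict_ground_eq])
  · refine h4.isIsomorphic ((binaryPG_isRep t).delete _) h5 (injOn_id _) ?_
    rw [h6, image_id, delete_ground, binaryPG_ground]
    ext y
    constructor
    · rintro ⟨x, ⟨hx0, hxA, hxS⟩, rfl⟩
      refine ⟨hf0 x hxA hx0, ?_⟩
      rintro ⟨z, hz, hzx⟩
      exact hxS (hfinj (hSA hz) hxA hzx ▸ hz)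
    · rintro ⟨hy0, hyS⟩
      obtain ⟨x, hxA, rfl⟩ := hfsurj y
      refine ⟨x, ⟨?_, hxA, fun h => hyS (mem_image_of_mem f h)⟩, rfl⟩
      rintro rfl
      exact hy0 (map_zero f)

theorem IsMinimalBinaryNonComatroid.exists_isSumCircuit {α : Type u} {M : Matroid α}
    (hM : M.IsMinimalBinaryNonComatroid) {r : ℕ} (hr : M.eRank = r) (h6 : 6 ≤ r)
    {v : α → Fin r → ZMod 2} (hv : M.IsRep v) :
    ∃ C : Finset (Fin r → ZMod 2), ((C : Set (Fin r → ZMod 2)) = v '' M.E ∨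
      (C : Set (Fin r → ZMod 2)) = {x | x ≠ 0} \ (v '' M.E)) ∧ IsSumCircuit C := by
  set X := v '' M.E with hX
  have hinj := hv.injOn hM.isSimple
  have h0 : ∀ e ∈ M.E, v e ≠ 0 := fun e he => hv.ne_zero hM.isSimple he
  have hX0 : X ⊆ {x | x ≠ 0} := by rintro _ ⟨e, he, rfl⟩; exact h0 e he
  have hspan : span (ZMod 2) X = ⊤ :=
    Submodule.eq_top_of_finrank_eq (by rw [hv.finrank_span hr, finrank_fin_fun])
  -- As X spans, a proper subspace cuts out a proper flat.
  have hflat : ∀ U : Submodule (ZMod 2) (Fin r → ZMod 2), U ≠ ⊤ →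
      (M.restrict {e ∈ M.E | v e ∈ U}).IsBinaryComatroid := by
    refine fun U hU => hM.flat_comatroid _ (hv.isFlat U) fun h => hU ?_
    rw [eq_top_iff, ← hspan, span_le]
    rintro _ ⟨e, he, rfl⟩
    rw [← h] at he
    exact he.2
  have himg : ∀ U : Submodule (ZMod 2) (Fin r → ZMod 2),
      v '' (M.restrict {e ∈ M.E | v e ∈ U}).E = {x | x ∈ X ∧ x ∈ U} := by
    intro U
    rw [restrict_ground_eq]
    ext x
    constructor
    · rintro ⟨e, ⟨he, heU⟩, rfl⟩; exact ⟨mem_image_of_mem v he, heU⟩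
    · rintro ⟨⟨e, he, rfl⟩, heU⟩; exact ⟨e, ⟨he, heU⟩, rfl⟩
  have hrestr : ∀ U : Submodule (ZMod 2) (Fin r → ZMod 2),
      (M.restrict {e ∈ M.E | v e ∈ U}).IsRep v := fun U => hv.restrict fun e he => he.1
  have hcom : ∀ U : Submodule (ZMod 2) (Fin r → ZMod 2), U ≠ ⊤ →
      (liftPG.{u} r {x | x ∈ X ∧ x ∈ U}).IsBinaryComatroid := by
    intro U hU
    rw [← himg U, ← (hrestr U).isBinaryComatroid_iff (hinj.mono fun e he => he.1)
      fun e he => h0 e he.1]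
    exact hflat U hU
  have hnot : ¬ (liftPG.{u} r X).IsBinaryComatroid := fun h =>
    hM.not_comatroid ((hv.isBinaryComatroid_iff hinj h0).2 h)
  have hsplit : ∀ {Z : Set (Fin r → ZMod 2)}, Z ⊆ {x | x ≠ 0} →
      (∀ U : Submodule (ZMod 2) (Fin r → ZMod 2), U ≠ ⊤ →
        (liftPG.{u} r {x | x ∈ Z ∧ x ∈ U}).IsBinaryComatroid) → Splits Z ⊤ →
      (liftPG.{u} r Z).IsBinaryComatroid := by
    rintro Z hZ0 hZ ⟨A, B, hA, hB, hAB, hsub⟩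
    have := isBinaryComatroid_liftPG_union hAB (fun x hx => hx.2) (fun x hx => hx.2)
      (fun x hx => hZ0 hx.1) (fun x hx => hZ0 hx.1) (hZ A hA.ne) (hZ B hB.ne)
    convert this using 2
    ext x
    exact ⟨fun hx => (hsub x hx mem_top).imp (⟨hx, ·⟩) (⟨hx, ·⟩), fun hx => hx.elim (·.1) (·.1)⟩
  set Y : Set (Fin r → ZMod 2) := {x | x ≠ 0} \ X with hY
  have hYcom : ∀ U : Submodule (ZMod 2) (Fin r → ZMod 2), U ≠ ⊤ →
      (liftPG.{u} r {x | x ∈ Y ∧ x ∈ U}).IsBinaryComatroid := by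
    intro U hU
    convert isBinaryComatroid_liftPG_compl (A := U) (fun x hx => hx.2) (fun x hx => hX0 hx.1)
      (hcom U hU) using 2
    ext x
    simp only [hY, mem_sdiff, mem_ofPred_eq]
    tauto
  refine exists_isSumCircuit_of_critical (by rwa [finrank_fin_fun]) (fun x hx => ?_)
    (fun h => hX0 h rfl) (fun h => h.1 rfl) (fun h => hnot (hsplit hX0 hcom h)) (fun h => hnot ?_)
    fun U hU hU' => ?_
  · by_cases hxX : x ∈ X
    exacts [Or.inl hxX, Or.inr ⟨hx, hxX⟩]
  -- If Y splits, it is a comatroid, and so is its complement X.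
  · convert isBinaryComatroid_liftPG_compl (A := ⊤) (fun x _ => mem_top)
      (fun x hx => hx.1) (hsplit (Z := Y) (fun x hx => hx.1) hYcom h) using 2
    ext x
    simp only [hY, mem_sdiff, mem_ofPred_eq, mem_top]
    exact ⟨fun hx => ⟨hX0 hx, trivial, fun h => h.2 hx⟩, fun hx => by tauto⟩
  · have h1 := (hflat U hU').hereditarilySplits v (hrestr U)
    rw [himg U] at h1
    exact (h1 U hU).imp (fun h => h.mono fun x hx hxU _ => ⟨hx, hxU⟩)
      fun h => h.mono fun x hx _ _ hx' => hx.2 hx'.1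

end Matroid

/-- The complement is determined only up to isomorphism. The second alternative therefore speaks of
every complement, and asserts existence as well so as not to be vacuous. -/
theorem theorem4p9 {α : Type u} (M : Matroid α) (hM : M.IsMinimalBinaryNonComatroid)
    (r : ℕ) (hr : M.eRank = r) (h6 : 6 ≤ r) :
    M.IsCircuit M.E ∨
      ((∃ N : Matroid (Fin r → ZMod 2), M.IsBinaryComplement r N) ∧
        ∀ {β : Type v} (N : Matroid β), M.IsBinaryComplement r N → N.IsCircuit N.E) := by
  open Matroid in
  refine or_iff_not_imp_left.2 fun hMc => ⟨?_, fun N hN => ?_⟩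
  · obtain ⟨k, v, hv⟩ := hM.isBinary
    have hv : M.IsRep v := hv
    -- The given representation may live in a space of dimension other than r; its span has
    -- dimension r and is carried onto GF(2)^r.
    obtain ⟨e⟩ : Nonempty (Submodule.span (ZMod 2) (v '' M.E) ≃ₗ[ZMod 2] (Fin r → ZMod 2)) :=
      ⟨LinearEquiv.ofFinrankEq _ _ (by rw [hv.finrank_span hr, Module.finrank_fin_fun])⟩
    obtain ⟨f, hf⟩ := e.toLinearMap.exists_extend
    have hrep := hv.comp f fun x hx y hy hxy => by
      have h1 := LinearMap.congr_fun hf ⟨x, hx⟩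
      have h2 := LinearMap.congr_fun hf ⟨y, hy⟩
      simp only [LinearMap.comp_apply, Submodule.subtype_apply, LinearEquiv.coe_coe] at h1 h2
      rw [h1, h2] at hxy
      simpa using e.injective hxy
    have hT : (f ∘ v) '' M.E ⊆ (binaryPG r).E := by
      rintro _ ⟨x, hx, rfl⟩
      exact hrep.ne_zero hM.isSimple hx
    refine ⟨_, _, hT, hrep.isIsomorphic ((binaryPG_isRep r).restrict hT)
      (hrep.injOn hM.isSimple) (injOn_id _) (by rw [restrict_ground_eq, image_id]),
      ((binaryPG_isRep r).delete _).isIsomorphic ((binaryPG_isRep r).delete _) (injOn_id _)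
        (injOn_id _) rfl⟩
  · obtain ⟨T, hT, hMT, hNT⟩ := hN
    obtain ⟨v, hv, hvT, -⟩ := hMT.exists_isRep ((binaryPG_isRep r).restrict hT)
    obtain ⟨w, hw, hwT, hwi⟩ := hNT.exists_isRep ((binaryPG_isRep r).delete T)
    obtain ⟨C, hC | hC, hcir⟩ := hM.exists_isSumCircuit hr h6 hv
    · exact absurd (hv.isCircuit (hv.injOn hM.isSimple) hcir hC) hMc
    · refine hw.isCircuit (hwi (injOn_id _)) hcir ?_
      rw [hC, hwT, hvT, image_id, image_id, restrict_ground_eq, delete_ground, binaryPG_ground]
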